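/- Let $\theta_i=z_i\,\partial/\partial z_i$ ($i=1,2$), and consider the Picard–Fuchs operators of the mirror family of the elliptic fibration $X_{18}(1,1,1,6,9)$ over $\mathbb P^2$, $$\mathcal L_1=\theta_1(\theta_1-3\theta_2)-12z_1(6\theta_1+1)(6\theta_1+5),\qquad \mathcal L_2=\theta_2^3+z_2\prod_{i=0}^{2}(3\theta_2-\theta_1+i),$$ with discriminants $$\Delta_1=(1-432z_1)^3-27z_2(432z_1)^3,\qquad \Delta_2=1+27z_2 .$$ Let $X_0=1+\cdots$, $X_1=X_0\log z_1+S_1$, $X_2=X_0\log z_2+S_2$ be the solutions of $\mathcal L_1X=\mathcal L_2X=0$ with $X_0,S_1,S_2\in\mathbb C[[z_1,z_2]]$, normalized by $X_0(0)=1$ and $S_1(0)=S_2(0)=0$ (they exist and are unique). Put $$q_E=\exp(X_1/X_0)=z_1+\cdots,\qquad q_B=\exp(X_2/X_0)=z_2+\cdots,$$ so that every power series in $z_1,z_2$ is uniquely a power series in $q_E,q_B$. For a rational function $f\in\mathbb C(z_1,z_2)$ let $\tilde f$ be the rational function obtained by the substitution $$(z_1,z_2)\mapsto\Big(\tfrac1{432}-z_1,\;-\frac{(432z_1)^3z_2}{(1-432z_1)^3}\Big).$$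 For integers $g\ge1$ and $m,n\ge0$ let $V_0^{(g,m,n)}$ be the space of all $$f=\frac{p(z_1)\,z_2^n}{(\Delta_1\Delta_2)^{2g-2}}$$ with $p\in\mathbb C[z_1]$ of degree at most $m$, and let $V_0^{(g,+\infty,n)}$ be the union of these spaces over all $m$. Let $$V_1^{(g,m,n)}=\{f\in V_0^{(g,m,n)}:\tilde f\in V_0^{(g,m,n)}\},\qquad V_2^{(g,m,n)}=\{f\in V_1^{(g,m,n)}:\tilde f=(-1)^{g-1}f\}.$$ With $\eta(q)^{24}=q\prod_{r\ge1}(1-q^r)^{24}$, every $f\in V_0^{(g,+\infty,n)}$ has an expansion $$X_0^{2g-2}f=\sum_{k\ge n}p_k(q_E)\Big(\frac{q_E}{\eta(q_E)^{24}}\Big)^{3k/2}q_B^k,\qquad p_k\in\mathbb C[[q_E]],$$ and $p_n\neq0$ if $f\ne0$. Let $W_0^{(g,n)}$ be the space of those $f\in V_0^{(g,+\infty,n)}$ for which $p_n$ is (the $q$-expansion of) a modular form of weight $18n+2g-2$ for $SL(2,\mathbb Z)$. Let $\mathcal M_w$ denote the space of (holomorphic) modular forms of weight $w$ for $SL(2,\mathbb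 Z)$; in particular $\mathcal M_w=0$ for $w<0$. **Proposition.** For all integers $g\ge1$ and $n\ge0$, $$W_0^{(g,n)}=V_2^{(g,\,[\frac{19}{3}(g-1)],\,n)} .$$ Moreover, if $n\le 2g-2$, then $f\mapsto p_n$ is a linear isomorphism $W_0^{(g,n)}\to\mathcal M_{18n+2g-2}$; and if $n>2g-2$, then $f\mapsto p_n/\eta^{72(n-2g+2)}$ is a linear isomorphism $W_0^{(g,n)}\to\mathcal M_{74(g-1)-18n}$. -/

import Mathlib

open scoped MatrixGroups

namespace X18

/-- Polynomials in the two complex structure coordinates. Index `0` is the fibre coordinate `z₁`,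
index `1` is the base coordinate `z₂`. -/
abbrev Poly : Type := MvPolynomial (Fin 2) ℂ
/-- Formal power series in `z₁, z₂` (expansions at the large volume point `z₁ = z₂ = 0`), and also
formal power series in the flat coordinates `q_E, q_B`. -/
abbrev Series : Type := MvPowerSeries (Fin 2) ℂ
/-- The field `ℂ(z₁, z₂)` of rational functions. -/
abbrev RatFun : Type := FractionRing Poly

noncomputable section


/-- The logarithmic derivative `θ_i = z_i ∂/∂z_i` on power series. -/
def theta (i : Fin 2) : Series →ₗ[ℂ] Series :=
  LinearMap.mulLeft ℂ (MvPowerSeries.X i : Series) ∘ₗ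
    (MvPowerSeries.pderiv (R := ℂ) i : Series →ₗ[ℂ] Series)

lemma coeff_theta (i : Fin 2) (A : Series) (d : Fin 2 →₀ ℕ) :
    MvPowerSeries.coeff d (theta i A) = (d i : ℂ) * MvPowerSeries.coeff d A := by
  simp only [theta, LinearMap.coe_comp, Function.comp_apply, LinearMap.mulLeft_apply,
    Derivation.coeFn_coe,
    MvPowerSeries.X, MvPowerSeries.coeff_monomial_mul, one_mul, MvPowerSeries.coeff_pderiv]
  split_ifs with h
  · have h1 : 1 ≤ d i := by simpa using h i
    rw [tsub_add_cancel_of_le h]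
    simp [Nat.cast_sub h1]
    ring
  · have h1 : d i = 0 := by
      by_contra hne
      exact h (by simpa [Finsupp.single_le_iff] using Nat.one_le_iff_ne_zero.mpr hne)
    simp [h1]

/-- The pair `(A, B)` stands for `A + B₁ log z₁ + B₂ log z₂`. -/
abbrev LogSeries : Type := Series × (Fin 2 → Series)

/-- `θ_i` on `A + ∑_j B_j log z_j`, using `θ_i log z_j = δ_{ij}`. -/
def logTheta (i : Fin 2) : Module.End ℂ LogSeries where
  toFun w := (theta i w.1 + w.2 i, fun j => theta i (w.2 j))
  map_add' v w := by
    ext1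
    · simp; abel
    · funext j; simp
  map_smul' c w := by
    ext1
    · simp
    · funext j; simp

/-- Multiplication by `z_i`. -/
def mulZ (i : Fin 2) : Module.End ℂ LogSeries := Algebra.lsmul ℂ ℂ LogSeries (MvPowerSeries.X i : Series)

/-- The Picard-Fuchs operator `θ₁ (θ₁ - 3 θ₂) - 12 z₁ (6 θ₁ + 1) (6 θ₁ + 5)`. -/
def PF1 : Module.End ℂ LogSeries :=
  logTheta 0 * (logTheta 0 - 3 * logTheta 1)
    - 12 * mulZ 0 * (6 * logTheta 0 + 1) * (6 * logTheta 0 + 5)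

/-- The Picard-Fuchs operator
`θ₂³ + z₂ (3 θ₂ - θ₁) (3 θ₂ - θ₁ + 1) (3 θ₂ - θ₁ + 2)`. -/
def PF2 : Module.End ℂ LogSeries :=
  logTheta 1 ^ 3 + mulZ 1 * ((3 * logTheta 1 - logTheta 0) * (3 * logTheta 1 - logTheta 0 + 1)
    * (3 * logTheta 1 - logTheta 0 + 2))

/-- The power series solution `X₀ = 1 + ⋯` and the two single-logarithmic solutions
`X_i = X₀ log z_i + S_i`, `S_i = 0 + ⋯`, of the Picard-Fuchs system at the large volume point. -/
structure IsLargeVolumeBasis (X₀ S₁ S₂ : Series) : Prop where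
  pf_zero : PF1 (X₀, 0) = 0 ∧ PF2 (X₀, 0) = 0
  pf_one : PF1 (S₁, ![X₀, 0]) = 0 ∧ PF2 (S₁, ![X₀, 0]) = 0
  pf_two : PF1 (S₂, ![0, X₀]) = 0 ∧ PF2 (S₂, ![0, X₀]) = 0
  const_zero : MvPowerSeries.constantCoeff X₀ = 1
  const_one : MvPowerSeries.constantCoeff S₁ = 0
  const_two : MvPowerSeries.constantCoeff S₂ = 0

/-- `(6a)! / ((2a)! (3a)!)`. -/
def frobA (a : ℕ) : ℂ := (6 * a).factorial / ((2 * a).factorial * (3 * a).factorial)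
/-- The derivative of `Γ(1+6a) / (Γ(1+2a) Γ(1+3a))` at a natural number `a`, with its Euler
constant term left out. -/
def frobA' (a : ℕ) : ℂ :=
  frobA a * (6 * harmonic (6 * a) - 2 * harmonic (2 * a) - 3 * harmonic (3 * a) : ℚ)
/-- `1 / b!³`. -/
def frobB (b : ℕ) : ℂ := 1 / (b.factorial : ℂ) ^ 3
/-- The derivative of `1 / Γ(1+b)³` at a natural number `b`, with its Euler constant term left out.
The Euler constants cancel in the Frobenius series. -/
def frobB' (b : ℕ) : ℂ := frobB b * (-3 * harmonic b : ℚ)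
/-- `1 / Γ(1+m)` for an integer `m`. -/
def frobG : ℤ → ℂ
  | .ofNat m => 1 / m.factorial
  | .negSucc _ => 0
/-- The derivative of `1 / Γ(1+m)` at an integer `m`, with its Euler constant term left out. -/
def frobG' : ℤ → ℂ
  | .ofNat m => -(harmonic m : ℚ) / m.factorial
  | .negSucc k => (-1) ^ k * k.factorial

/-- The holomorphic period `X₀ = ∑ (6a)! / ((2a)! (3a)! b!³ (a-3b)!) z₁^a z₂^b`. That `X0`, `S1`, `S2`
are the normalized solutions of the Picard-Fuchs system, and the only ones, is
`isLargeVolumeBasis_iff` below. -/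
def X0 : Series := fun d => frobA (d 0) * frobB (d 1) * frobG (d 0 - 3 * d 1)
/-- The power series part of `X₁ = X₀ log z₁ + S₁`. -/
def S1 : Series := fun d => frobA' (d 0) * frobB (d 1) * frobG (d 0 - 3 * d 1)
    + frobA (d 0) * frobB (d 1) * frobG' (d 0 - 3 * d 1)
/-- The power series part of `X₂ = X₀ log z₂ + S₂`. -/
def S2 : Series := fun d => frobA (d 0) * frobB' (d 1) * frobG (d 0 - 3 * d 1)
    - 3 * (frobA (d 0) * frobB (d 1) * frobG' (d 0 - 3 * d 1))

lemma frobG_rec (m : ℤ) : frobG (m - 1) = m * frobG m := by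
  rcases m with (_ | m) | k
  · show frobG (-1) = _
    show (0 : ℂ) = _
    simp
  · have : (Int.ofNat (m + 1) - 1 : ℤ) = Int.ofNat m := by simp
    rw [this]
    simp [frobG, Nat.factorial_succ]
    field_simp
  · have : (Int.negSucc k - 1 : ℤ) = Int.negSucc (k + 1) := by lia
    rw [this]; simp [frobG]

lemma frobG'_rec (m : ℤ) : frobG' (m - 1) = m * frobG' m + frobG m := by
  rcases m with (_ | m) | k
  · show frobG' (Int.negSucc 0) = _
    simp [frobG, frobG']
  · have : (Int.ofNat (m + 1) - 1 : ℤ) = Int.ofNat m := by simp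
    rw [this]
    have : (m : ℂ) + 1 ≠ 0 := by exact_mod_cast Nat.succ_ne_zero m
    simp [frobG, frobG', Nat.factorial_succ, harmonic_succ]
    field_simp
    ring
  · have : (Int.negSucc k - 1 : ℤ) = Int.negSucc (k + 1) := by lia
    rw [this]; simp [frobG, frobG', Nat.factorial_succ, Int.negSucc_eq]; ring

lemma frobB_rec (b : ℕ) : (b + 1 : ℂ) ^ 3 * frobB (b + 1) = frobB b := by
  have : (b : ℂ) + 1 ≠ 0 := by exact_mod_cast Nat.succ_ne_zero b
  simp [frobB, Nat.factorial_succ]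
  field_simp

lemma frobB'_rec (b : ℕ) :
    (b + 1 : ℂ) ^ 3 * frobB' (b + 1) + 3 * (b + 1) ^ 2 * frobB (b + 1) = frobB' b := by
  have : (b : ℂ) + 1 ≠ 0 := by exact_mod_cast Nat.succ_ne_zero b
  have h := frobB_rec b
  simp only [frobB', harmonic_succ, ← h]
  push_cast
  field_simp
  ring

lemma frobA_rec (a : ℕ) :
    (a + 1 : ℂ) * frobA (a + 1) = 12 * (6 * a + 1) * (6 * a + 5) * frobA a := by
  have h6 : 6 * (a + 1) = 6 * a + 1 + 1 + 1 + 1 + 1 + 1 := by ring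
  have h2 : 2 * (a + 1) = 2 * a + 1 + 1 := by ring
  have h3 : 3 * (a + 1) = 3 * a + 1 + 1 + 1 := by ring
  have e1 : (2 * a + 1 : ℂ) ≠ 0 := by exact_mod_cast Nat.succ_ne_zero (2 * a)
  have e2 : (3 * a + 1 : ℂ) ≠ 0 := by exact_mod_cast Nat.succ_ne_zero (3 * a)
  have e3 : (3 * a + 2 : ℂ) ≠ 0 := by exact_mod_cast Nat.succ_ne_zero (3 * a + 1)
  have e4 : (a + 1 : ℂ) ≠ 0 := by exact_mod_cast Nat.succ_ne_zero a
  have f1 : ((2 * a).factorial : ℂ) ≠ 0 := by exact_mod_cast Nat.factorial_ne_zero _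
  have f2 : ((3 * a).factorial : ℂ) ≠ 0 := by exact_mod_cast Nat.factorial_ne_zero _
  have g1 : ((2 * (a + 1)).factorial : ℂ) = 2 * (a + 1) * (2 * a + 1) * (2 * a).factorial := by
    rw [h2]; push_cast [Nat.factorial_succ]; ring
  have g2 : ((3 * (a + 1)).factorial : ℂ)
      = 3 * (a + 1) * (3 * a + 2) * (3 * a + 1) * (3 * a).factorial := by
    rw [h3]; push_cast [Nat.factorial_succ]; ring
  have g3 : ((6 * (a + 1)).factorial : ℂ)
      = (6 * (a + 1)) * (6 * a + 5) * (2 * (3 * a + 2)) * (3 * (2 * a + 1)) * (2 * (3 * a + 1))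
        * (6 * a + 1) * (6 * a).factorial := by
    rw [h6]; push_cast [Nat.factorial_succ]; ring
  rw [frobA, frobA, g1, g2, g3, mul_div_assoc', mul_div_assoc', div_eq_div_iff
    (by simp only [ne_eq, mul_eq_zero, not_or, e1, e2, e3, e4, f1, f2]; norm_num)
    (mul_ne_zero f1 f2)]
  ring

lemma frobA'_rec (a : ℕ) :
    (a + 1 : ℂ) * frobA' (a + 1) + frobA (a + 1)
      = 12 * (6 * a + 1) * (6 * a + 5) * frobA' a + 12 * (72 * a + 36) * frobA a := by
  have h6 : 6 * (a + 1) = 6 * a + 1 + 1 + 1 + 1 + 1 + 1 := by ring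
  have h2 : 2 * (a + 1) = 2 * a + 1 + 1 := by ring
  have h3 : 3 * (a + 1) = 3 * a + 1 + 1 + 1 := by ring
  have e1 : (2 * a + 1 : ℂ) ≠ 0 := by exact_mod_cast Nat.succ_ne_zero (2 * a)
  have e2 : (3 * a + 1 : ℂ) ≠ 0 := by exact_mod_cast Nat.succ_ne_zero (3 * a)
  have e3 : (3 * a + 2 : ℂ) ≠ 0 := by exact_mod_cast Nat.succ_ne_zero (3 * a + 1)
  have e4 : (a + 1 : ℂ) ≠ 0 := by exact_mod_cast Nat.succ_ne_zero a
  have e5 : (6 * a + 1 : ℂ) ≠ 0 := by exact_mod_cast Nat.succ_ne_zero (6 * a)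
  have e6 : (6 * a + 5 : ℂ) ≠ 0 := by exact_mod_cast Nat.succ_ne_zero (6 * a + 4)
  have hh : ((6 * harmonic (6 * (a + 1)) - 2 * harmonic (2 * (a + 1))
      - 3 * harmonic (3 * (a + 1)) : ℚ) : ℂ)
      = (6 * harmonic (6 * a) - 2 * harmonic (2 * a) - 3 * harmonic (3 * a) : ℚ)
        + 6 / (6 * a + 1) + 6 / (6 * a + 5) - 1 / (a + 1) := by
    rw [h6, h2, h3]
    simp only [harmonic_succ]
    push_cast
    have t1 : (6 * a + 1 + 1 : ℂ)⁻¹ = 2⁻¹ * (3 * a + 1 : ℂ)⁻¹ := by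
      rw [← mul_inv]; congr 1; ring
    have t2 : (6 * a + 2 + 1 : ℂ)⁻¹ = 3⁻¹ * (2 * a + 1 : ℂ)⁻¹ := by
      rw [← mul_inv]; congr 1; ring
    have t3 : (6 * a + 3 + 1 : ℂ)⁻¹ = 2⁻¹ * (3 * a + 2 : ℂ)⁻¹ := by
      rw [← mul_inv]; congr 1; ring
    have t4 : (6 * a + 4 + 1 : ℂ)⁻¹ = (6 * a + 5 : ℂ)⁻¹ := by congr 1; ring
    have t5 : (6 * a + 5 + 1 : ℂ)⁻¹ = 6⁻¹ * (a + 1 : ℂ)⁻¹ := by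
      rw [← mul_inv]; congr 1; ring
    have t6 : (2 * a + 1 + 1 : ℂ)⁻¹ = 2⁻¹ * (a + 1 : ℂ)⁻¹ := by
      rw [← mul_inv]; congr 1; ring
    have t7 : (3 * a + 1 + 1 : ℂ)⁻¹ = (3 * a + 2 : ℂ)⁻¹ := by congr 1; ring
    have t8 : (3 * a + 2 + 1 : ℂ)⁻¹ = 3⁻¹ * (a + 1 : ℂ)⁻¹ := by
      rw [← mul_inv]; congr 1; ring
    rw [t1, t2, t3, t4, t5, t6, t7, t8]
    ring
  have h := frobA_rec a
  rw [frobA', frobA', hh]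
  linear_combination
    (((6 * harmonic (6 * a) - 2 * harmonic (2 * a) - 3 * harmonic (3 * a) : ℚ) : ℂ)
      + 6 * (6 * a + 1 : ℂ)⁻¹ + 6 * (6 * a + 5 : ℂ)⁻¹) * h
    + 72 * (6 * a + 5) * frobA a * mul_inv_cancel₀ e5
    + 72 * (6 * a + 1) * frobA a * mul_inv_cancel₀ e6
    - frobA (a + 1) * mul_inv_cancel₀ e4


lemma coeff_X_mul' (i : Fin 2) (A : Series) (d : Fin 2 →₀ ℕ) :
    MvPowerSeries.coeff d (MvPowerSeries.X i * A)
      = if 1 ≤ d i then MvPowerSeries.coeff (d - Finsupp.single i 1) A else 0 := by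
  simp only [MvPowerSeries.X, MvPowerSeries.coeff_monomial_mul, one_mul, Finsupp.single_le_iff]

lemma end_2 (w : LogSeries) : (2 : Module.End ℂ LogSeries) w = (2 : ℂ) • w := by
  rw [Module.End.ofNat_apply, ← Nat.cast_ofNat (R := ℂ), Nat.cast_smul_eq_nsmul]

lemma end_3 (w : LogSeries) : (3 : Module.End ℂ LogSeries) w = (3 : ℂ) • w := by
  rw [Module.End.ofNat_apply, ← Nat.cast_ofNat (R := ℂ), Nat.cast_smul_eq_nsmul]

lemma end_5 (w : LogSeries) : (5 : Module.End ℂ LogSeries) w = (5 : ℂ) • w := by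
  rw [Module.End.ofNat_apply, ← Nat.cast_ofNat (R := ℂ), Nat.cast_smul_eq_nsmul]

lemma end_6 (w : LogSeries) : (6 : Module.End ℂ LogSeries) w = (6 : ℂ) • w := by
  rw [Module.End.ofNat_apply, ← Nat.cast_ofNat (R := ℂ), Nat.cast_smul_eq_nsmul]

lemma end_12 (w : LogSeries) : (12 : Module.End ℂ LogSeries) w = (12 : ℂ) • w := by
  rw [Module.End.ofNat_apply, ← Nat.cast_ofNat (R := ℂ), Nat.cast_smul_eq_nsmul]

lemma PF1_apply_fst (A : Series) (B : Fin 2 → Series) (d : Fin 2 →₀ ℕ) :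
    MvPowerSeries.coeff d (PF1 (A, B)).1
      = (d 0 : ℂ) * (d 0 - 3 * d 1) * MvPowerSeries.coeff d A
        + (2 * d 0 - 3 * d 1) * MvPowerSeries.coeff d (B 0)
        - 3 * d 0 * MvPowerSeries.coeff d (B 1)
        - 12 * (if 1 ≤ d 0 then
            ((6 * (d 0 - 1 : ℂ) + 1) * (6 * (d 0 - 1 : ℂ) + 5)
                * MvPowerSeries.coeff (d - Finsupp.single 0 1) A
              + (72 * (d 0 - 1 : ℂ) + 36) * MvPowerSeries.coeff (d - Finsupp.single 0 1) (B 0))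
            else 0) := by
  simp only [PF1, logTheta, mulZ, end_2, end_3, end_5, end_6, end_12, Module.End.mul_apply, LinearMap.sub_apply,
    LinearMap.add_apply, Module.End.one_apply, LinearMap.coe_mk, AddHom.coe_mk,
    Algebra.lsmul_coe, Prod.fst_sub, Prod.fst_add, Prod.smul_fst, Prod.snd_sub, Prod.snd_add,
    Prod.smul_snd, map_add, map_sub, map_smul, Pi.add_apply, Pi.sub_apply, Pi.smul_apply,
    smul_eq_mul, coeff_theta, coeff_X_mul']
  split_ifs with h
  · simp [Nat.cast_sub h]
    ring
  · simp; ring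

lemma PF1_apply_snd (A : Series) (B : Fin 2 → Series) (j : Fin 2) (d : Fin 2 →₀ ℕ) :
    MvPowerSeries.coeff d ((PF1 (A, B)).2 j)
      = (d 0 : ℂ) * (d 0 - 3 * d 1) * MvPowerSeries.coeff d (B j)
        - 12 * (if 1 ≤ d 0 then
            (6 * (d 0 - 1 : ℂ) + 1) * (6 * (d 0 - 1 : ℂ) + 5)
                * MvPowerSeries.coeff (d - Finsupp.single 0 1) (B j)
            else 0) := by
  simp only [PF1, logTheta, mulZ, end_2, end_3, end_5, end_6, end_12, Module.End.mul_apply, LinearMap.sub_apply,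
    LinearMap.add_apply, Module.End.one_apply, LinearMap.coe_mk, AddHom.coe_mk,
    Algebra.lsmul_coe, Prod.fst_sub, Prod.fst_add, Prod.smul_fst, Prod.snd_sub, Prod.snd_add,
    Prod.smul_snd, map_add, map_sub, map_smul, Pi.add_apply, Pi.sub_apply, Pi.smul_apply,
    smul_eq_mul, coeff_theta, coeff_X_mul']
  split_ifs with h
  · simp [Nat.cast_sub h]
    ring
  · simp; ring

lemma PF2_apply_fst (A : Series) (B : Fin 2 → Series) (d : Fin 2 →₀ ℕ) :
    MvPowerSeries.coeff d (PF2 (A, B)).1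
      = (d 1 : ℂ) ^ 3 * MvPowerSeries.coeff d A
        + 3 * (d 1 : ℂ) ^ 2 * MvPowerSeries.coeff d (B 1)
        + (if 1 ≤ d 1 then
            (3 * (d 1 - 1 : ℂ) - d 0) * (3 * (d 1 - 1 : ℂ) - d 0 + 1)
                * (3 * (d 1 - 1 : ℂ) - d 0 + 2)
                * MvPowerSeries.coeff (d - Finsupp.single 1 1) A
              + (3 * (3 * (d 1 - 1 : ℂ) - d 0) ^ 2 + 6 * (3 * (d 1 - 1 : ℂ) - d 0) + 2)
                * (3 * MvPowerSeries.coeff (d - Finsupp.single 1 1) (B 1)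
                  - MvPowerSeries.coeff (d - Finsupp.single 1 1) (B 0))
            else 0) := by
  simp only [PF2, pow_succ, pow_zero, logTheta, mulZ, end_2, end_3, end_5, end_6, end_12, Module.End.mul_apply,
    LinearMap.sub_apply, one_mul,
    LinearMap.add_apply, Module.End.one_apply, LinearMap.coe_mk, AddHom.coe_mk,
    Algebra.lsmul_coe, Prod.fst_sub, Prod.fst_add, Prod.smul_fst, Prod.snd_sub, Prod.snd_add,
    Prod.smul_snd, map_add, map_sub, map_smul, Pi.add_apply, Pi.sub_apply, Pi.smul_apply,
    smul_eq_mul, coeff_theta, coeff_X_mul']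
  split_ifs with h
  · simp [Nat.cast_sub h]
    ring
  · simp; ring

lemma PF2_apply_snd (A : Series) (B : Fin 2 → Series) (j : Fin 2) (d : Fin 2 →₀ ℕ) :
    MvPowerSeries.coeff d ((PF2 (A, B)).2 j)
      = (d 1 : ℂ) ^ 3 * MvPowerSeries.coeff d (B j)
        + (if 1 ≤ d 1 then
            (3 * (d 1 - 1 : ℂ) - d 0) * (3 * (d 1 - 1 : ℂ) - d 0 + 1)
                * (3 * (d 1 - 1 : ℂ) - d 0 + 2)
                * MvPowerSeries.coeff (d - Finsupp.single 1 1) (B j)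
            else 0) := by
  simp only [PF2, pow_succ, pow_zero, logTheta, mulZ, end_2, end_3, end_5, end_6, end_12, Module.End.mul_apply,
    LinearMap.sub_apply, one_mul,
    LinearMap.add_apply, Module.End.one_apply, LinearMap.coe_mk, AddHom.coe_mk,
    Algebra.lsmul_coe, Prod.fst_sub, Prod.fst_add, Prod.smul_fst, Prod.snd_sub, Prod.snd_add,
    Prod.smul_snd, map_add, map_sub, map_smul, Pi.add_apply, Pi.sub_apply, Pi.smul_apply,
    smul_eq_mul, coeff_theta, coeff_X_mul']
  split_ifs with h
  · simp [Nat.cast_sub h]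
    ring
  · simp; ring

lemma coeff_X0 (d : Fin 2 →₀ ℕ) : MvPowerSeries.coeff d X0
    = frobA (d 0) * frobB (d 1) * frobG (d 0 - 3 * d 1) := rfl

lemma coeff_S1 (d : Fin 2 →₀ ℕ) : MvPowerSeries.coeff d S1
    = frobA' (d 0) * frobB (d 1) * frobG (d 0 - 3 * d 1)
      + frobA (d 0) * frobB (d 1) * frobG' (d 0 - 3 * d 1) := rfl

lemma coeff_S2 (d : Fin 2 →₀ ℕ) : MvPowerSeries.coeff d S2
    = frobA (d 0) * frobB' (d 1) * frobG (d 0 - 3 * d 1)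
      - 3 * (frobA (d 0) * frobB (d 1) * frobG' (d 0 - 3 * d 1)) := rfl

lemma frobG_neg {m : ℤ} (hm : m < 0) : frobG m = 0 := by
  rcases m with m | k
  · exact absurd hm (by simp)
  · rfl

lemma frobG_rec3 (m : ℤ) : frobG m = (m + 1) * (m + 2) * (m + 3) * frobG (m + 3) := by
  have h1 := frobG_rec (m + 1)
  have h2 := frobG_rec (m + 2)
  have h3 := frobG_rec (m + 3)
  rw [show m + 1 - 1 = m by ring] at h1
  rw [show m + 2 - 1 = m + 1 by ring] at h2
  rw [show m + 3 - 1 = m + 2 by ring] at h3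
  rw [h1, h2, h3]; push_cast; ring

lemma frobG'_rec3 (m : ℤ) : frobG' m = (m + 1) * (m + 2) * (m + 3) * frobG' (m + 3)
    + ((m + 2) * (m + 3) + (m + 1) * (m + 3) + (m + 1) * (m + 2)) * frobG (m + 3) := by
  have h1 := frobG'_rec (m + 1)
  have h2 := frobG'_rec (m + 2)
  have h3 := frobG'_rec (m + 3)
  have k2 := frobG_rec (m + 2)
  have k3 := frobG_rec (m + 3)
  rw [show m + 1 - 1 = m by ring] at h1
  rw [show m + 2 - 1 = m + 1 by ring] at h2 k2
  rw [show m + 3 - 1 = m + 2 by ring] at h3 k3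
  rw [h1, h2, h3, k2, k3]; push_cast; ring

lemma isLargeVolumeBasis_frobenius : IsLargeVolumeBasis X0 S1 S2 := by
  have z0 : ∀ d : Fin 2 →₀ ℕ, (d - (Finsupp.single 0 1 : Fin 2 →₀ ℕ)) 0 = d 0 - 1 := fun d => by simp
  have z1 : ∀ d : Fin 2 →₀ ℕ, (d - (Finsupp.single 0 1 : Fin 2 →₀ ℕ)) 1 = d 1 := fun d => by simp
  have y0 : ∀ d : Fin 2 →₀ ℕ, (d - (Finsupp.single 1 1 : Fin 2 →₀ ℕ)) 0 = d 0 := fun d => by simp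
  have y1 : ∀ d : Fin 2 →₀ ℕ, (d - (Finsupp.single 1 1 : Fin 2 →₀ ℕ)) 1 = d 1 - 1 := fun d => by simp
  have g0 : ∀ a b : ℕ, frobG (a - 3 * b) = (a + 1 - 3 * b) * frobG ((a + 1 : ℕ) - 3 * b) := by
    intro a b
    have := frobG_rec ((a + 1 : ℕ) - 3 * b)
    rw [show ((a + 1 : ℕ) - 3 * b - 1 : ℤ) = a - 3 * b by push_cast; ring] at this
    rw [this]; push_cast; ring
  have g1 : ∀ a b : ℕ, frobG' (a - 3 * b) = (a + 1 - 3 * b) * frobG' ((a + 1 : ℕ) - 3 * b)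
      + frobG ((a + 1 : ℕ) - 3 * b) := by
    intro a b
    have := frobG'_rec ((a + 1 : ℕ) - 3 * b)
    rw [show ((a + 1 : ℕ) - 3 * b - 1 : ℤ) = a - 3 * b by push_cast; ring] at this
    rw [this]; push_cast; ring
  have k0 : ∀ a b : ℕ, frobG (a - 3 * (b + 1 : ℕ))
      = -((3 * b - a) * (3 * b - a + 1) * (3 * b - a + 2)) * frobG (a - 3 * b) := by
    intro a b
    have := frobG_rec3 (a - 3 * (b + 1 : ℕ))
    rw [show ((a : ℤ) - 3 * (b + 1 : ℕ) + 3 : ℤ) = a - 3 * b by push_cast; ring] at this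
    rw [this]; push_cast; ring
  have k1 : ∀ a b : ℕ, frobG' (a - 3 * (b + 1 : ℕ))
      = -((3 * b - a) * (3 * b - a + 1) * (3 * b - a + 2)) * frobG' (a - 3 * b)
        + (3 * (3 * b - a) ^ 2 + 6 * (3 * b - a) + 2) * frobG (a - 3 * b) := by
    intro a b
    have := frobG'_rec3 (a - 3 * (b + 1 : ℕ))
    rw [show ((a : ℤ) - 3 * (b + 1 : ℕ) + 3 : ℤ) = a - 3 * b by push_cast; ring] at this
    rw [this]; push_cast; ring
  have e1 : ∀ d : Fin 2 →₀ ℕ, (d 0 : ℂ) * (d 0 - 3 * d 1) * MvPowerSeries.coeff d X0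
        - 12 * (if 1 ≤ d 0 then
            (6 * (d 0 - 1 : ℂ) + 1) * (6 * (d 0 - 1 : ℂ) + 5)
                * MvPowerSeries.coeff (d - Finsupp.single 0 1) X0
            else 0) = 0 := by
    intro d
    simp only [coeff_X0, z0, z1]
    rcases d 0 with _ | a
    · simp
    · simp only [le_add_iff_nonneg_left, zero_le, if_true, Nat.add_sub_cancel, g0 a (d 1)]
      push_cast
      linear_combination frobB (d 1) * (a + 1 - 3 * d 1) * frobG (a + 1 - 3 * d 1) * frobA_rec a
  have e2 : ∀ d : Fin 2 →₀ ℕ, (d 1 : ℂ) ^ 3 * MvPowerSeries.coeff d X0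
        + (if 1 ≤ d 1 then
            (3 * (d 1 - 1 : ℂ) - d 0) * (3 * (d 1 - 1 : ℂ) - d 0 + 1)
                * (3 * (d 1 - 1 : ℂ) - d 0 + 2)
                * MvPowerSeries.coeff (d - Finsupp.single 1 1) X0
            else 0) = 0 := by
    intro d
    simp only [coeff_X0, y0, y1]
    rcases d 1 with _ | b
    · simp
    · simp only [le_add_iff_nonneg_left, zero_le, if_true, Nat.add_sub_cancel, k0 (d 0) b]
      push_cast
      linear_combination -(frobA (d 0) * ((3 * b - d 0) * (3 * b - d 0 + 1) * (3 * b - d 0 + 2))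
        * frobG (d 0 - 3 * b)) * frobB_rec b
  refine ⟨⟨?_, ?_⟩, ⟨?_, ?_⟩, ⟨?_, ?_⟩, ?_, ?_, ?_⟩
  · ext1
    · ext d
      rw [PF1_apply_fst]
      simpa using e1 d
    · funext j; ext d
      rw [PF1_apply_snd]
      simp
  · ext1
    · ext d
      rw [PF2_apply_fst]
      simpa using e2 d
    · funext j; ext d
      rw [PF2_apply_snd]
      simp
  · ext1
    · ext d
      rw [PF1_apply_fst]
      simp only [Matrix.cons_val_zero, Matrix.cons_val_one, map_zero, Prod.fst_zero, coeff_X0, coeff_S1, z0, z1]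
      rcases d 0 with _ | a
      · rcases d 1 with _ | b
        · simp
        · simp [frobG_neg (show (-(3 * (b + 1 : ℤ))) < 0 by lia)]
      · simp only [le_add_iff_nonneg_left, zero_le, if_true, Nat.add_sub_cancel, g0 a (d 1), g1 a (d 1)]
        push_cast
        linear_combination frobB (d 1) * (a + 1 - 3 * d 1) * frobG (a + 1 - 3 * d 1) * frobA'_rec a
          + frobB (d 1) * ((a + 1 - 3 * d 1) * frobG' (a + 1 - 3 * d 1)
            + frobG (a + 1 - 3 * d 1)) * frobA_rec a
    · funext j; ext d
      rw [PF1_apply_snd]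
      fin_cases j
      · simpa using e1 d
      · simp
  · ext1
    · ext d
      rw [PF2_apply_fst]
      simp only [Matrix.cons_val_zero, Matrix.cons_val_one, map_zero, Prod.fst_zero, coeff_X0, coeff_S1, y0, y1]
      rcases d 1 with _ | b
      · simp
      · simp only [le_add_iff_nonneg_left, zero_le, if_true, Nat.add_sub_cancel, k0 (d 0) b, k1 (d 0) b]
        push_cast
        linear_combination (-(frobA' (d 0)
            * ((3 * b - d 0) * (3 * b - d 0 + 1) * (3 * b - d 0 + 2)) * frobG (d 0 - 3 * b))
          + frobA (d 0) * (-((3 * b - d 0) * (3 * b - d 0 + 1) * (3 * b - d 0 + 2))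
              * frobG' (d 0 - 3 * b)
            + (3 * (3 * b - d 0) ^ 2 + 6 * (3 * b - d 0) + 2) * frobG (d 0 - 3 * b)))
          * frobB_rec b
    · funext j; ext d
      rw [PF2_apply_snd]
      fin_cases j
      · simpa using e2 d
      · simp
  · ext1
    · ext d
      rw [PF1_apply_fst]
      simp only [Matrix.cons_val_zero, Matrix.cons_val_one, map_zero, Prod.fst_zero, coeff_X0, coeff_S2, z0, z1]
      rcases d 0 with _ | a
      · simp
      · simp only [le_add_iff_nonneg_left, zero_le, if_true, Nat.add_sub_cancel, g0 a (d 1), g1 a (d 1)]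
        push_cast
        linear_combination (frobB' (d 1) * (a + 1 - 3 * d 1) * frobG (a + 1 - 3 * d 1)
          - 3 * frobB (d 1) * ((a + 1 - 3 * d 1) * frobG' (a + 1 - 3 * d 1)
            + frobG (a + 1 - 3 * d 1))) * frobA_rec a
    · funext j; ext d
      rw [PF1_apply_snd]
      fin_cases j
      · simp
      · simpa using e1 d
  · ext1
    · ext d
      rw [PF2_apply_fst]
      simp only [Matrix.cons_val_zero, Matrix.cons_val_one, map_zero, Prod.fst_zero, coeff_X0, coeff_S2, y0, y1]
      rcases d 1 with _ | b
      · simp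
      · simp only [le_add_iff_nonneg_left, zero_le, if_true, Nat.add_sub_cancel, k0 (d 0) b, k1 (d 0) b]
        push_cast
        linear_combination -(frobA (d 0)
            * ((3 * b - d 0) * (3 * b - d 0 + 1) * (3 * b - d 0 + 2)) * frobG (d 0 - 3 * b))
            * frobB'_rec b
          - 3 * frobA (d 0) * (-((3 * b - d 0) * (3 * b - d 0 + 1) * (3 * b - d 0 + 2))
              * frobG' (d 0 - 3 * b)
            + (3 * (3 * b - d 0) ^ 2 + 6 * (3 * b - d 0) + 2) * frobG (d 0 - 3 * b))
          * frobB_rec b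
    · funext j; ext d
      rw [PF2_apply_snd]
      fin_cases j
      · simp
      · simpa using e2 d
  · rw [← MvPowerSeries.coeff_zero_eq_constantCoeff_apply, coeff_X0]
    simp [frobA, frobB, show frobG 0 = 1 by simp [show (0 : ℤ) = Int.ofNat 0 from rfl, frobG]]
  · rw [← MvPowerSeries.coeff_zero_eq_constantCoeff_apply, coeff_S1]
    simp [frobA, frobB, frobA', show frobG' 0 = 0 by
      rw [show (0 : ℤ) = Int.ofNat 0 from rfl]; simp only [frobG']; simp]
  · rw [← MvPowerSeries.coeff_zero_eq_constantCoeff_apply, coeff_S2]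
    simp [frobA, frobB, frobB', show frobG' 0 = 0 by
      rw [show (0 : ℤ) = Int.ofNat 0 from rfl]; simp only [frobG']; simp]

lemma eq_zero_of_PF (A : Series) (h1 : PF1 (A, 0) = 0) (h2 : PF2 (A, 0) = 0)
    (h0 : MvPowerSeries.constantCoeff A = 0) : A = 0 := by
  have e1 : ∀ d : Fin 2 →₀ ℕ, MvPowerSeries.coeff d (PF1 (A, 0)).1 = 0 := by simp [h1]
  have e2 : ∀ d : Fin 2 →₀ ℕ, MvPowerSeries.coeff d (PF2 (A, 0)).1 = 0 := by simp [h2]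
  simp only [PF1_apply_fst, PF2_apply_fst, Pi.zero_apply, map_zero] at e1 e2
  have key : ∀ a b : ℕ, ∀ d : Fin 2 →₀ ℕ, d 0 = a → d 1 = b → MvPowerSeries.coeff d A = 0 := by
    intro a b
    induction b generalizing a with
    | zero =>
      induction a with
      | zero =>
        intro d hd0 hd1
        have : d = 0 := by ext i; fin_cases i <;> simpa
        rw [this]; simpa using h0
      | succ a ih =>
        intro d hd0 hd1
        have h := e1 d
        rw [ih (d - (Finsupp.single 0 1 : Fin 2 →₀ ℕ)) (by simp [hd0]) (by simp [hd1])] at h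
        have ha : (a + 1 : ℂ) ≠ 0 := by exact_mod_cast Nat.succ_ne_zero a
        simpa [hd0, hd1, ha] using h
    | succ b ih =>
      intro d hd0 hd1
      have h := e2 d
      rw [ih a (d - (Finsupp.single 1 1 : Fin 2 →₀ ℕ)) (by simp [hd0]) (by simp [hd1])] at h
      have hb : (b + 1 : ℂ) ≠ 0 := by exact_mod_cast Nat.succ_ne_zero b
      simpa [hd0, hd1, hb] using h
  ext d
  simpa using key _ _ d rfl rfl

/-- `X0`, `S1`, `S2` are the unique normalized solutions of the Picard-Fuchs system. -/
theorem isLargeVolumeBasis_iff (A S T : Series) :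
    IsLargeVolumeBasis A S T ↔ A = X0 ∧ S = S1 ∧ T = S2 := by
  have hF := isLargeVolumeBasis_frobenius
  constructor
  · intro h
    have hA : A = X0 := by
      refine sub_eq_zero.mp (eq_zero_of_PF (A - X0) ?_ ?_ ?_)
      · rw [show ((A - X0, 0) : LogSeries) = (A, 0) - (X0, 0) by simp, map_sub, h.pf_zero.1,
          hF.pf_zero.1, sub_zero]
      · rw [show ((A - X0, 0) : LogSeries) = (A, 0) - (X0, 0) by simp, map_sub, h.pf_zero.2,
          hF.pf_zero.2, sub_zero]
      · rw [map_sub, h.const_zero, hF.const_zero, sub_self]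
    subst hA
    refine ⟨rfl, ?_, ?_⟩
    · refine sub_eq_zero.mp (eq_zero_of_PF (S - S1) ?_ ?_ ?_)
      · rw [show ((S - S1, 0) : LogSeries) = (S, ![X0, 0]) - (S1, ![X0, 0]) by simp, map_sub,
          h.pf_one.1, hF.pf_one.1, sub_zero]
      · rw [show ((S - S1, 0) : LogSeries) = (S, ![X0, 0]) - (S1, ![X0, 0]) by simp, map_sub,
          h.pf_one.2, hF.pf_one.2, sub_zero]
      · rw [map_sub, h.const_one, hF.const_one, sub_self]
    · refine sub_eq_zero.mp (eq_zero_of_PF (T - S2) ?_ ?_ ?_)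
      · rw [show ((T - S2, 0) : LogSeries) = (T, ![0, X0]) - (S2, ![0, X0]) by simp, map_sub,
          h.pf_two.1, hF.pf_two.1, sub_zero]
      · rw [show ((T - S2, 0) : LogSeries) = (T, ![0, X0]) - (S2, ![0, X0]) by simp, map_sub,
          h.pf_two.2, hF.pf_two.2, sub_zero]
      · rw [map_sub, h.const_two, hF.const_two, sub_self]
  · rintro ⟨rfl, rfl, rfl⟩
    exact hF

/-- `exp A` for a power series `A` without constant term. -/
def expSeries (A : Series) : Series := PowerSeries.subst A (PowerSeries.exp ℂ)

lemma constantCoeff_expSeries (A : Series) (hA : MvPowerSeries.constantCoeff A = 0) :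
    MvPowerSeries.constantCoeff (expSeries A) = 1 := by
  rw [expSeries, PowerSeries.constantCoeff_subst (PowerSeries.HasSubst.of_constantCoeff_zero hA),
    finsum_eq_single _ 0]
  · simp
  · intro n hn
    simp [hA, hn]

/-- The flat coordinates `q_E = exp (X₁ / X₀) = z₁ exp (S₁ / X₀)` and
`q_B = exp (X₂ / X₀) = z₂ exp (S₂ / X₀)` as power series in `z₁, z₂`. -/
def flatCoord : Fin 2 → Series :=
  ![MvPowerSeries.X 0 * expSeries (S1 * X0⁻¹), MvPowerSeries.X 1 * expSeries (S2 * X0⁻¹)]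

/-- The quotients `q_E / z₁` and `q_B / z₂`. -/
def flatUnit : Fin 2 → Series := ![expSeries (S1 * X0⁻¹), expSeries (S2 * X0⁻¹)]

lemma flatCoord_eq (i : Fin 2) : flatCoord i = MvPowerSeries.X i * flatUnit i := by
  fin_cases i <;> rfl

lemma constantCoeff_flatUnit (i : Fin 2) : MvPowerSeries.constantCoeff (flatUnit i) = 1 := by
  have h := isLargeVolumeBasis_frobenius
  fin_cases i
  · exact constantCoeff_expSeries _ (by simp [h.const_one])
  · exact constantCoeff_expSeries _ (by simp [h.const_two])

/-- The coefficient of `z^d` in the monomial `q^e`. -/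
def flatMat (e d : Fin 2 →₀ ℕ) : ℂ :=
  MvPowerSeries.coeff d (e.prod fun s k => flatCoord s ^ k)

lemma flatMat_eq (e d : Fin 2 →₀ ℕ) : flatMat e d = if e ≤ d then
    MvPowerSeries.coeff (d - e) (e.prod fun s k => flatUnit s ^ k) else 0 := by
  have : (e.prod fun s k => flatCoord s ^ k)
      = MvPowerSeries.monomial e (1 : ℂ) * (e.prod fun s k => flatUnit s ^ k) := by
    simp only [flatCoord_eq, mul_pow, Finsupp.prod_mul]
    rw [MvPowerSeries.monomial_one_eq]
  rw [flatMat, this, MvPowerSeries.coeff_monomial_mul]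
  simp

lemma flatMat_self (d : Fin 2 →₀ ℕ) : flatMat d d = 1 := by
  simp [flatMat_eq, Finsupp.prod, constantCoeff_flatUnit]

lemma hasSubst_flatCoord : MvPowerSeries.HasSubst flatCoord :=
  MvPowerSeries.hasSubst_of_constantCoeff_zero fun i => by simp [flatCoord_eq]

lemma coeff_subst_flatCoord (F : Series) (d : Fin 2 →₀ ℕ) :
    MvPowerSeries.coeff d (MvPowerSeries.subst flatCoord F)
      = MvPowerSeries.coeff d F + ∑ e ∈ Finset.Iio d, MvPowerSeries.coeff e F * flatMat e d := by
  rw [MvPowerSeries.coeff_subst hasSubst_flatCoord,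
    finsum_eq_sum_of_support_subset (s := Finset.Iic d)]
  · rw [← Finset.Iio_insert, Finset.sum_insert (by simp)]
    simp only [smul_eq_mul]
    change _ * flatMat d d + _ = _
    rw [flatMat_self, mul_one]
    rfl
  · intro e he
    by_contra hne
    have hle : ¬ e ≤ d := by simpa using hne
    apply he
    change _ • flatMat e d = 0
    simp [flatMat_eq, hle]

/-- Every power series in `z₁, z₂` is in a unique way a power series in `q_E, q_B`. -/
theorem existsUnique_flatExpansion (G : Series) :
    ∃! F : Series, MvPowerSeries.subst flatCoord F = G := by
  let F : Series := (wellFounded_lt (α := Fin 2 →₀ ℕ)).fix fun d ih =>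
    MvPowerSeries.coeff d G
      - ∑ e ∈ (Finset.Iio d).attach, ih e.1 (Finset.mem_Iio.mp e.2) * flatMat e.1 d
  have hF : ∀ d, MvPowerSeries.coeff d F = MvPowerSeries.coeff d G
      - ∑ e ∈ Finset.Iio d, MvPowerSeries.coeff e F * flatMat e d := by
    intro d
    rw [← Finset.sum_attach (Finset.Iio d)]
    exact (wellFounded_lt (α := Fin 2 →₀ ℕ)).fix_eq _ d
  refine ⟨F, ?_, ?_⟩
  · ext d
    rw [coeff_subst_flatCoord, hF d]
    ring
  · intro F' hF'
    ext d
    induction d using WellFoundedLT.induction with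
    | ind d ih =>
      have h1 := coeff_subst_flatCoord F' d
      rw [hF', Finset.sum_congr rfl fun e he => by rw [ih e (Finset.mem_Iio.mp he)]] at h1
      rw [hF d, h1]
      ring

/-- The expansion in `q_E, q_B` of a power series in `z₁, z₂`. -/
def flatExpansion (G : Series) : Series := (existsUnique_flatExpansion G).choose

lemma subst_flatExpansion (G : Series) :
    MvPowerSeries.subst flatCoord (flatExpansion G) = G :=
  (existsUnique_flatExpansion G).choose_spec.1

lemma flatExpansion_unique {F G : Series} (h : MvPowerSeries.subst flatCoord F = G) :
    F = flatExpansion G :=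
  (existsUnique_flatExpansion G).choose_spec.2 F h

lemma flatExpansion_add (G H : Series) :
    flatExpansion (G + H) = flatExpansion G + flatExpansion H := by
  refine (flatExpansion_unique ?_).symm
  rw [MvPowerSeries.subst_add hasSubst_flatCoord, subst_flatExpansion, subst_flatExpansion]

lemma flatExpansion_smul (c : ℂ) (G : Series) :
    flatExpansion (c • G) = c • flatExpansion G := by
  refine (flatExpansion_unique ?_).symm
  rw [MvPowerSeries.subst_smul hasSubst_flatCoord, subst_flatExpansion]

/-- The discriminant `Δ₁ = (1 - 432 z₁)³ - 27 z₂ (432 z₁)³`. -/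
def disc1 : Poly := (1 - 432 * MvPolynomial.X 0) ^ 3
  - 27 * MvPolynomial.X 1 * (432 * MvPolynomial.X 0) ^ 3
/-- The discriminant `Δ₂ = 1 + 27 z₂`. -/
def disc2 : Poly := 1 + 27 * MvPolynomial.X 1

/-- The coordinates `z₁`, `z₂` as rational functions. -/
def z (i : Fin 2) : RatFun := algebraMap Poly RatFun (MvPolynomial.X i)

/-- The images `1/432 - z₁` and `-(432 z₁)³ z₂ / (1 - 432 z₁)³` of `z₁` and `z₂` under the involution. -/
def involutionPoint : Fin 2 → RatFun :=
  ![1 / 432 - z 0, -((432 * z 0) ^ 3 * z 1 / (1 - 432 * z 0) ^ 3)]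

lemma one_sub_ne_zero : (1 - 432 * MvPolynomial.X 0 : Poly) ≠ 0 := by
  intro h
  have := congrArg MvPolynomial.constantCoeff h
  simp at this

lemma algebraMap_432 : algebraMap Poly RatFun 432 = 432 := by
  exact_mod_cast map_natCast (algebraMap Poly RatFun) 432

lemma involution_injective : Function.Injective
    (MvPolynomial.aeval involutionPoint : Poly →ₐ[ℂ] RatFun) := by
  let s : Poly := MvPolynomial.X 0 * (1 - 432 * MvPolynomial.X 0)
  have hs : s ≠ 0 := mul_ne_zero (MvPolynomial.X_ne_zero _) one_sub_ne_zero
  have key : ∀ P : Poly, ∃ (N : ℕ) (Q : Poly),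
      algebraMap Poly RatFun Q
        = algebraMap Poly RatFun ((1 - 432 * MvPolynomial.X 0) ^ N)
          * MvPolynomial.aeval involutionPoint P
      ∧ ∀ a b : ℂ, 1 - 432 * a ≠ 0 → MvPolynomial.eval ![a, b] Q
        = (1 - 432 * a) ^ N * MvPolynomial.eval
          ![1 / 432 - a, -((432 * a) ^ 3 * b / (1 - 432 * a) ^ 3)] P := by
    intro P
    induction P using MvPolynomial.induction_on with
    | C c => exact ⟨0, MvPolynomial.C c, by simp [MvPolynomial.algebraMap_eq,
        IsScalarTower.algebraMap_apply ℂ Poly RatFun], by simp⟩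
    | add P Q hP hQ =>
      obtain ⟨N, P', h1, h2⟩ := hP
      obtain ⟨M, Q', h3, h4⟩ := hQ
      refine ⟨N + M, (1 - 432 * MvPolynomial.X 0) ^ M * P'
        + (1 - 432 * MvPolynomial.X 0) ^ N * Q', ?_, ?_⟩
      · rw [map_add, map_mul, map_mul, h1, h3, pow_add, map_mul, map_add]
        ring
      · intro a b hab
        simp only [map_add, map_mul, map_pow, h2 a b hab, h4 a b hab]
        simp
        ring
    | mul_X P i hP =>
      obtain ⟨N, P', h1, h2⟩ := hP
      fin_cases i
      · refine ⟨N, P' * (MvPolynomial.C (1 / 432) - MvPolynomial.X 0), ?_, ?_⟩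
        · have : algebraMap Poly RatFun (MvPolynomial.C (1 / 432)) = 1 / 432 := by
            rw [← MvPolynomial.algebraMap_eq, ← IsScalarTower.algebraMap_apply ℂ Poly RatFun,
              map_div₀, map_one]
            congr 1
            exact_mod_cast map_natCast (algebraMap ℂ RatFun) 432
          rw [map_mul, map_mul, map_sub, this, h1]
          simp [involutionPoint, z]
          ring
        · intro a b hab
          simp only [map_mul, h2 a b hab]
          simp
          ring
      · refine ⟨N + 3, P' * (-((432 * MvPolynomial.X 0) ^ 3 * MvPolynomial.X 1)), ?_, ?_⟩
        · have h0 : (1 - 432 * z 0 : RatFun) ≠ 0 := by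
            have := (map_ne_zero_iff _ (IsFractionRing.injective Poly RatFun)).mpr one_sub_ne_zero
            simpa [z, algebraMap_432] using this
          rw [map_mul, map_mul, h1]
          have e1 : MvPolynomial.aeval involutionPoint (MvPolynomial.X 1 : Poly)
            = -((432 * z 0) ^ 3 * z 1 / (1 - 432 * z 0) ^ 3) := by simp [involutionPoint]
          have e2 : algebraMap Poly RatFun (-((432 * MvPolynomial.X 0) ^ 3 * MvPolynomial.X 1))
            = -((432 * z 0) ^ 3 * z 1) := by simp [z, algebraMap_432]
          have e3 : ∀ k : ℕ, algebraMap Poly RatFun ((1 - 432 * MvPolynomial.X 0) ^ k)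
            = (1 - 432 * z 0) ^ k := by intro k; simp [z, algebraMap_432]
          have e4 : (1 - 432 * z 0) ^ 3
              * -((432 * z 0) ^ 3 * z 1 / (1 - 432 * z 0) ^ 3) = -((432 * z 0) ^ 3 * z 1) := by
            rw [mul_neg, mul_div_cancel₀ _ (pow_ne_zero 3 h0)]
          change _ * algebraMap Poly RatFun (-((432 * MvPolynomial.X 0) ^ 3 * MvPolynomial.X 1))
            = _ * (_ * MvPolynomial.aeval involutionPoint (MvPolynomial.X 1 : Poly))
          rw [e1, e2, e3, e3, pow_add, ← e4]
          ring
        · intro a b hab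
          simp only [map_mul, h2 a b hab]
          have e5 : (1 - 432 * a) ^ 3
              * -((432 * a) ^ 3 * b / (1 - 432 * a) ^ 3) = -((432 * a) ^ 3 * b) := by
            rw [mul_neg, mul_div_cancel₀ _ (pow_ne_zero 3 hab)]
          simp
          rw [pow_add]
          linear_combination (((1 - 432 * a) ^ N * MvPolynomial.eval
            ![432⁻¹ - a, -((432 * a) ^ 3 * b / (1 - 432 * a) ^ 3)] P)) * e5
  rw [injective_iff_map_eq_zero]
  intro P hP
  obtain ⟨N, Q, h1, h2⟩ := key P
  have hQ : Q = 0 := by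
    rw [hP, mul_zero] at h1
    exact (map_eq_zero_iff _ (IsFractionRing.injective Poly RatFun)).mp h1
  have hPs : P * s = 0 := by
    refine MvPolynomial.funext fun x => ?_
    by_cases hx : x 0 = 0 ∨ 1 - 432 * x 0 = 0
    · rcases hx with hx | hx <;> simp [s, hx]
    · push Not at hx
      have hx1 : 432 * x 0 ≠ 0 := mul_ne_zero (by norm_num) hx.1
      have h3 := h2 (1 / 432 - x 0) (-((432 * x 0) ^ 3 * x 1 / (1 - 432 * x 0) ^ 3))
        (by rw [show 1 - 432 * (1 / 432 - x 0) = 432 * x 0 by ring]; exact hx1)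
      rw [hQ, show 1 - 432 * (1 / 432 - x 0) = 432 * x 0 by ring,
        show 432 * (1 / 432 - x 0) = 1 - 432 * x 0 by ring,
        show 1 / 432 - (1 / 432 - x 0) = x 0 by ring] at h3
      have h4 : -((1 - 432 * x 0) ^ 3 * -((432 * x 0) ^ 3 * x 1 / (1 - 432 * x 0) ^ 3)
          / (432 * x 0) ^ 3) = x 1 := by
        have h6 := hx.2
        have h7 := hx.1
        rw [mul_neg, mul_div_cancel₀ _ (pow_ne_zero 3 h6), neg_div, neg_neg,
          mul_div_cancel_left₀ _ (pow_ne_zero 3 hx1)]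
      rw [h4, map_zero, eq_comm, mul_eq_zero] at h3
      have h5 : MvPolynomial.eval ![x 0, x 1] P = 0 :=
        h3.resolve_left (pow_ne_zero _ hx1)
      have h6 : ![x 0, x 1] = x := by ext i; fin_cases i <;> rfl
      rw [h6] at h5
      simp [h5]
  exact (mul_eq_zero.mp hPs).resolve_right hs

/-- The involution `f ↦ f̃` on rational functions, i.e. the substitution
`z₁ ↦ 1/432 - z₁`, `z₂ ↦ -(432 z₁)³ z₂ / (1 - 432 z₁)³`. -/
def involution : RatFun →ₐ[ℂ] RatFun := IsFractionRing.liftAlgHom involution_injective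

lemma involution_z0 : involution (z 0) = 1 / 432 - z 0 := by
  simp [involution, z, IsFractionRing.liftAlgHom_apply, involutionPoint]

lemma involution_z1 :
    involution (z 1) = -((432 * z 0) ^ 3 * z 1 / (1 - 432 * z 0) ^ 3) := by
  simp [involution, z, IsFractionRing.liftAlgHom_apply, involutionPoint]

/-- The linear map `p ↦ p(z₁) z₂^n / (Δ₁ Δ₂)^(2g-2)`. The truncated subtraction is correct for `g ≥ 1`. -/
def ambiguity (g n : ℕ) : Polynomial ℂ →ₗ[ℂ] RatFun :=
  LinearMap.mulRight ℂ (z 1 ^ n / algebraMap Poly RatFun (disc1 * disc2) ^ (2 * g - 2))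
    ∘ₗ (Polynomial.aeval (z 0)).toLinearMap

lemma ambiguity_apply (g n : ℕ) (p : Polynomial ℂ) : ambiguity g n p
    = Polynomial.aeval (z 0) p * z 1 ^ n
      / algebraMap Poly RatFun (disc1 * disc2) ^ (2 * g - 2) := by
  simp [ambiguity, mul_div_assoc]

/-- The `p(z₁) z₂^n / (Δ₁ Δ₂)^(2g-2)` with `p` a polynomial of degree at most `m`. -/
def V0 (g m n : ℕ) : Submodule ℂ RatFun := (Polynomial.degreeLE ℂ m).map (ambiguity g n)
/-- The `p(z₁) z₂^n / (Δ₁ Δ₂)^(2g-2)` with `p` an arbitrary polynomial. -/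
def V0Top (g n : ℕ) : Submodule ℂ RatFun := LinearMap.range (ambiguity g n)
/-- The `f` such that `f` and `f̃` both lie in `V0 g m n`. -/
def V1 (g m n : ℕ) : Submodule ℂ RatFun := V0 g m n ⊓ (V0 g m n).comap involution.toLinearMap
/-- The `f` in `V1 g m n` with `f̃ = (-1)^(g-1) f`. -/
def V2 (g m n : ℕ) : Submodule ℂ RatFun :=
  V1 g m n ⊓ LinearMap.eqLocus involution.toLinearMap ((-1 : ℂ) ^ (g - 1) • LinearMap.id)

lemma mem_V2 {g m n : ℕ} {f : RatFun} :
    f ∈ V2 g m n ↔ f ∈ V0 g m n ∧ involution f ∈ V0 g m n ∧ involution f = (-1) ^ (g - 1) * f := by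
  simp only [V2, V1, Submodule.mem_inf, Submodule.mem_comap, LinearMap.mem_eqLocus,
    AlgHom.toLinearMap_apply, LinearMap.smul_apply, LinearMap.id_apply, and_assoc]
  simp only [Algebra.smul_def, map_pow, map_neg, map_one]

/-- The Taylor expansion at `z₁ = z₂ = 0` of a rational function that is regular there.
See `taylor_div` for arbitrary numerators and denominators. -/
def taylor (f : RatFun) : Series :=
  (IsFractionRing.num Poly f : Series) * ((IsFractionRing.den Poly f : Poly) : Series)⁻¹

lemma taylor_div (P Q : Poly) (hQ : MvPolynomial.constantCoeff Q ≠ 0) :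
    taylor (algebraMap Poly RatFun P / algebraMap Poly RatFun Q)
      = (P : Series) * (Q : Series)⁻¹ := by
  set f := algebraMap Poly RatFun P / algebraMap Poly RatFun Q with hf
  have hQ0 : Q ≠ 0 := by rintro rfl; simp at hQ
  have hinj := IsFractionRing.injective Poly RatFun
  have hd0 : (IsFractionRing.den Poly f : Poly) ≠ 0 :=
    nonZeroDivisors.ne_zero (IsFractionRing.den Poly f).2
  have h := IsFractionRing.mk'_num_den' Poly f
  have hmul : IsFractionRing.num Poly f * Q = P * (IsFractionRing.den Poly f : Poly) := by
    apply hinj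
    rw [map_mul, map_mul]
    rw [← div_eq_div_iff ((map_ne_zero_iff _ hinj).mpr hd0) ((map_ne_zero_iff _ hinj).mpr hQ0), h]
  have hdvd : (IsFractionRing.den Poly f : Poly) ∣ Q :=
    (IsFractionRing.num_den_reduced Poly f).symm.dvd_of_dvd_mul_left
      (hmul ▸ Dvd.intro_left P rfl)
  have hdc : MvPolynomial.constantCoeff (IsFractionRing.den Poly f : Poly) ≠ 0 := by
    obtain ⟨R, hR⟩ := hdvd
    intro h0
    apply hQ
    rw [hR, map_mul, h0, zero_mul]
  have hc : ∀ R : Poly, MvPowerSeries.constantCoeff (R : Series)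
      = MvPolynomial.constantCoeff R := by
    intro R
    rw [← MvPowerSeries.coeff_zero_eq_constantCoeff_apply, MvPolynomial.coeff_coe,
      MvPolynomial.constantCoeff_eq]
  have hmul' : (IsFractionRing.num Poly f : Series) * (Q : Series)
      = (P : Series) * ((IsFractionRing.den Poly f : Poly) : Series) := by
    rw [← MvPolynomial.coe_mul, ← MvPolynomial.coe_mul, hmul]
  rw [taylor, MvPowerSeries.eq_mul_inv_iff_mul_eq (by rwa [hc]), mul_right_comm, hmul',
    mul_assoc, MvPowerSeries.mul_inv_cancel _ (by rwa [hc]), mul_one]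

lemma taylor_ambiguity (g n : ℕ) (p : Polynomial ℂ) : taylor (ambiguity g n p)
    = (Polynomial.aeval (MvPolynomial.X 0 : Poly) p * MvPolynomial.X 1 ^ n : Poly)
      * (((disc1 * disc2) ^ (2 * g - 2) : Poly) : Series)⁻¹ := by
  have h : algebraMap Poly RatFun
      (Polynomial.aeval (MvPolynomial.X 0 : Poly) p * MvPolynomial.X 1 ^ n)
      = Polynomial.aeval (z 0) p * z 1 ^ n := by
    rw [map_mul, map_pow, ← Polynomial.aeval_algebraMap_apply]
    rfl
  rw [ambiguity_apply, ← taylor_div _ _ (by simp [disc1, disc2]), h, map_pow]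

/-- The coefficient of `q_B^k`, a power series in `q_E`, of a power series `G` in `z₁, z₂`. -/
def baseCoeff (G : Series) (k : ℕ) : PowerSeries ℂ := PowerSeries.mk fun i =>
  MvPowerSeries.coeff (Finsupp.single 0 i + Finsupp.single 1 k) (flatExpansion G)

lemma baseCoeff_add (G H : Series) (k : ℕ) :
    baseCoeff (G + H) k = baseCoeff G k + baseCoeff H k := by
  ext i; simp [baseCoeff, flatExpansion_add]

lemma baseCoeff_smul (c : ℂ) (G : Series) (k : ℕ) :
    baseCoeff (c • G) k = c • baseCoeff G k := by
  ext i; simp [baseCoeff, flatExpansion_smul]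

open scoped PowerSeries.WithPiTopology in
/-- `∏_{m ≥ 1} (1 - q^m)`, so that `η^24 = q * eulerProduct ^ 24`. -/
def eulerProduct : PowerSeries ℂ := ∏' m : ℕ, (1 - PowerSeries.X ^ (m + 1))

/-- The coefficient `p_k(q_E)` in the base degree expansion
`X₀^(2g-2) f = ∑_k p_k(q_E) (q_E / η(q_E)^24)^(3k/2) q_B^k`. Here
`(q / η^24)^(3k/2) = ∏_{m ≥ 1} (1 - q^m)^(-36k)`. -/
def fibreCoeff (g : ℕ) (f : RatFun) (k : ℕ) : PowerSeries ℂ :=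
  baseCoeff (X0 ^ (2 * g - 2) * taylor f) k * eulerProduct ^ (36 * k)

lemma fibreCoeff_add (g n k : ℕ) {f h : RatFun} (hf : f ∈ V0Top g n) (hh : h ∈ V0Top g n) :
    fibreCoeff g (f + h) k = fibreCoeff g f k + fibreCoeff g h k := by
  obtain ⟨p, rfl⟩ := hf
  obtain ⟨q, rfl⟩ := hh
  rw [← map_add]
  simp only [fibreCoeff, taylor_ambiguity]
  simp only [map_add, add_mul, MvPolynomial.coe_add, mul_add, baseCoeff_add]

lemma fibreCoeff_smul (g n k : ℕ) (c : ℂ) {f : RatFun} (hf : f ∈ V0Top g n) :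
    fibreCoeff g (c • f) k = c • fibreCoeff g f k := by
  obtain ⟨p, rfl⟩ := hf
  rw [← map_smul]
  simp only [fibreCoeff, taylor_ambiguity]
  simp only [map_smul, smul_mul_assoc, MvPolynomial.coe_smul, mul_smul_comm, baseCoeff_smul]

/-- The power series `P(q)` is the `q`-expansion of a modular form of weight `w` for `SL(2, ℤ)`
(holomorphic on the upper half plane and at the cusp). -/
def IsLevelOneForm (w : ℤ) (P : PowerSeries ℂ) : Prop :=
  ∃ M : ModularForm 𝒮ℒ w, UpperHalfPlane.qExpansion 1 M = P

/-- The `f = p(z₁) z₂^n / (Δ₁ Δ₂)^(2g-2)` whose leading coefficient `p_n(q_E)` is a modular form of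
weight `18n + 2g - 2` for `SL(2, ℤ)`. -/
def W0 (g n : ℕ) : Submodule ℂ RatFun where
  carrier := {f | f ∈ V0Top g n ∧ IsLevelOneForm (18 * (n : ℤ) + 2 * (g : ℤ) - 2) (fibreCoeff g f n)}
  zero_mem' := by
    refine ⟨zero_mem _, 0, ?_⟩
    have h := fibreCoeff_smul g n n 0 (zero_mem (V0Top g n))
    rw [zero_smul, zero_smul] at h
    rw [h]
    exact UpperHalfPlane.qExpansion_zero 1
  add_mem' := by
    rintro f h ⟨hf, M, hM⟩ ⟨hh, N, hN⟩
    refine ⟨add_mem hf hh, M + N, ?_⟩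
    rw [fibreCoeff_add g n n hf hh, ← hM, ← hN]
    exact ModularForm.qExpansion_add one_pos one_mem_strictPeriods_SL M N
  smul_mem' := by
    rintro c f ⟨hf, M, hM⟩
    refine ⟨Submodule.smul_mem _ c hf, c • M, ?_⟩
    rw [fibreCoeff_smul g n n c hf, ← hM]
    exact ModularForm.qExpansion_smul one_pos one_mem_strictPeriods_SL c M

open scoped PowerSeries.WithPiTopology in
lemma constantCoeff_eulerProduct : PowerSeries.constantCoeff eulerProduct = 1 := by
  simp [eulerProduct, (PowerSeries.WithPiTopology.multipliable_one_sub_X_pow ℂ).map_tprod _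
    (PowerSeries.WithPiTopology.continuous_constantCoeff ℂ)]

/-- The expansion of `f` starts in base degree `n`. -/
lemma fibreCoeff_of_lt {g n k : ℕ} {f : RatFun} (hf : f ∈ V0Top g n) (hk : k < n) :
    fibreCoeff g f k = 0 := by
  obtain ⟨p, rfl⟩ := hf
  have hG : ∀ d : Fin 2 →₀ ℕ, d 1 < n →
      MvPowerSeries.coeff d (X0 ^ (2 * g - 2) * taylor (ambiguity g n p)) = 0 := by
    refine MvPowerSeries.X_pow_dvd_iff.mp ?_
    rw [taylor_ambiguity, MvPolynomial.coe_mul, MvPolynomial.coe_pow, MvPolynomial.coe_X]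
    exact ((Dvd.intro_left _ rfl).mul_right _).mul_left _
  have hF : ∀ d : Fin 2 →₀ ℕ, d 1 < n → MvPowerSeries.coeff d
      (flatExpansion (X0 ^ (2 * g - 2) * taylor (ambiguity g n p))) = 0 := by
    intro d
    induction d using WellFoundedLT.induction with
    | ind d ih =>
      intro hd
      have h := coeff_subst_flatCoord
        (flatExpansion (X0 ^ (2 * g - 2) * taylor (ambiguity g n p))) d
      rw [subst_flatExpansion, hG d hd, Finset.sum_eq_zero, add_zero] at h
      · exact h.symm
      · intro e he
        have he' := Finset.mem_Iio.mp he
        rw [ih e he' ((he'.le 1).trans_lt hd), zero_mul]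
  have hb : baseCoeff (X0 ^ (2 * g - 2) * taylor (ambiguity g n p)) k = 0 := by
    ext i
    simp [baseCoeff, hF (Finsupp.single 0 i + Finsupp.single 1 k) (by simpa using hk)]
  rw [fibreCoeff, hb, zero_mul]

/-- For `f ≠ 0` the coefficient in base degree `n` does not vanish. -/
lemma fibreCoeff_ne_zero {g n : ℕ} {f : RatFun} (hf : f ∈ V0Top g n) (hf0 : f ≠ 0) :
    fibreCoeff g f n ≠ 0 := by
  intro h0
  have hlt : ∀ k ≤ n, baseCoeff (X0 ^ (2 * g - 2) * taylor f) k = 0 := by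
    intro k hk
    have : fibreCoeff g f k = 0 := by
      rcases hk.lt_or_eq with hk | rfl
      · exact fibreCoeff_of_lt hf hk
      · exact h0
    refine (mul_eq_zero.mp this).resolve_right (pow_ne_zero _ ?_)
    intro h
    have := constantCoeff_eulerProduct
    simp [h] at this
  obtain ⟨p, rfl⟩ := hf
  have hF : ∀ d : Fin 2 →₀ ℕ, d 1 ≤ n → MvPowerSeries.coeff d
      (flatExpansion (X0 ^ (2 * g - 2) * taylor (ambiguity g n p))) = 0 := by
    intro d hd
    have h := congrArg (PowerSeries.coeff (d 0)) (hlt (d 1) hd)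
    have hd' : Finsupp.single 0 (d 0) + Finsupp.single 1 (d 1) = d := by
      ext i; fin_cases i <;> simp
    simpa [baseCoeff, hd'] using h
  have hG : (MvPowerSeries.X 1 : Series) ^ (n + 1)
      ∣ X0 ^ (2 * g - 2) * taylor (ambiguity g n p) := by
    rw [MvPowerSeries.X_pow_dvd_iff]
    intro d hd
    rw [← subst_flatExpansion (X0 ^ (2 * g - 2) * taylor (ambiguity g n p)),
      coeff_subst_flatCoord, hF d (by lia), Finset.sum_eq_zero, add_zero]
    intro e he
    rw [hF e (((Finset.mem_Iio.mp he).le 1).trans (by lia)), zero_mul]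
  have hX : (MvPowerSeries.X 1 : Series) ≠ 0 := by
    intro h
    have := congrArg (MvPowerSeries.coeff (Finsupp.single 1 1)) h
    simp [MvPowerSeries.coeff_X] at this
  have hdvd : (MvPowerSeries.X 1 : Series)
      ∣ ((Polynomial.aeval (MvPolynomial.X 0 : Poly) p : Poly) : Series) := by
    rw [taylor_ambiguity, MvPolynomial.coe_mul, MvPolynomial.coe_pow, MvPolynomial.coe_X,
      show ∀ a b c d : Series, a * (b * c * d) = c * (a * d * b) by intros; ring, pow_succ,
      mul_dvd_mul_iff_left (pow_ne_zero _ hX)] at hG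
    refine (IsUnit.dvd_mul_left ?_).mp hG
    have hc : ∀ R : Poly, MvPowerSeries.constantCoeff (R : Series)
        = MvPolynomial.constantCoeff R := by
      intro R
      rw [← MvPowerSeries.coeff_zero_eq_constantCoeff_apply, MvPolynomial.coeff_coe,
        MvPolynomial.constantCoeff_eq]
    rw [MvPowerSeries.isUnit_iff_constantCoeff, map_mul, map_pow,
      isLargeVolumeBasis_frobenius.const_zero, MvPowerSeries.constantCoeff_inv, hc]
    simp [disc1, disc2]
  apply hf0
  have hp : p = 0 := by
    ext i
    have h := MvPowerSeries.X_dvd_iff.mp hdvd (Finsupp.single 0 i) (by simp)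
    rw [MvPolynomial.coeff_coe, Polynomial.aeval_eq_sum_range, MvPolynomial.coeff_sum] at h
    simp only [MvPolynomial.coeff_smul, MvPolynomial.coeff_X_pow, smul_eq_mul] at h
    by_cases hi : i ≤ p.natDegree
    · rw [Finset.sum_eq_single i] at h
      · simpa using h
      · intro b _ hb
        have : Finsupp.single (0 : Fin 2) b ≠ Finsupp.single 0 i := by
          intro hh; exact hb (Finsupp.single_injective _ hh)
        simp [this]
      · intro hh; exact absurd (Finset.mem_range.mpr (by lia)) hh
    · rw [Polynomial.coeff_eq_zero_of_natDegree_lt (by lia)]; simp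
  rw [hp, map_zero]

end

end X18

/-!
On `z₂ = 0` the period `X₀` solves the Picard–Fuchs equation of the elliptic fibre, whose solution
with value `1` at the origin is unique. By Ramanujan's differential equations `E₄^{1/4}` solves the
same equation in the coordinate `z` with `E₆ = E₄^{3/2} (1 - 864 z)`, and Abel's identity for the
Wronskians of `X₀` with `X₁` and `X₂` determines `q_E` and `q_B` on `z₂ = 0`. Hence, in the
coordinate `z₁`, one has `E₄ = X₀⁴`, `E₆ = X₀⁶ (1 - 864 z₁)` and `Δ = X₀¹² z₁ (1 - 432 z₁)`.

Level one forms of weight `2k` are therefore the series `X₀^{2k} Q(z₁)` with `3 deg Q ≤ k` and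
`Q(1/432 - z) = (-1)^k Q(z)`. The leading coefficient of `p(z₁) z₂ⁿ / (Δ₁ Δ₂)^{2g-2}` is
`X₀^{18n+2g-2} p(z₁) (1 - 432 z₁)^{3n-6(g-1)}`. The symmetry of the second factor says
`f̃ = (-1)^{g-1} f`, and its degree bound says `3 deg p ≤ 19 (g-1)`. When `n > 2g-2` the polynomial
`Q` is divisible by `(1 - 432 z)^{3(n-2g+2)}`, by symmetry also by `z^{3(n-2g+2)}`, so that the form
is divisible by `Δ^{3(n-2g+2)}`.
-/

namespace X18

noncomputable section

section TaylorSeries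

open Filter Topology UpperHalfPlane

/-- The Taylor series at `0` of a function of one complex variable, as a formal power series: it
turns analytic identities for `cuspFunction` into identities of `q`-expansions. -/
def taylorAtZero (f : ℂ → ℂ) : PowerSeries ℂ :=
  PowerSeries.mk fun m => (m.factorial : ℂ)⁻¹ * iteratedDeriv m f 0

variable {f h : ℂ → ℂ}

lemma taylorAtZero_congr (hfh : f =ᶠ[𝓝 0] h) : taylorAtZero f = taylorAtZero h := by
  ext m
  simp [taylorAtZero, hfh.iteratedDeriv_eq m]

lemma taylorAtZero_mul (hf : AnalyticAt ℂ f 0) (hh : AnalyticAt ℂ h 0) :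
    taylorAtZero (f * h) = taylorAtZero f * taylorAtZero h := by
  ext m
  simp only [taylorAtZero, PowerSeries.coeff_mk, PowerSeries.coeff_mul,
    iteratedDeriv_mul hf.contDiffAt hh.contDiffAt, Finset.mul_sum,
    Finset.Nat.sum_antidiagonal_eq_sum_range_succ_mk]
  refine Finset.sum_congr rfl fun i hi => ?_
  rw [Nat.cast_choose ℂ (Nat.lt_succ_iff.mp (Finset.mem_range.mp hi))]
  have hm : (m.factorial : ℂ) ≠ 0 := by exact_mod_cast m.factorial_ne_zero
  field_simp

lemma iteratedDeriv_polynomial_eval {𝕜 : Type*} [NontriviallyNormedField 𝕜] (p : Polynomial 𝕜)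
    (m : ℕ) (x : 𝕜) :
    iteratedDeriv m (fun y => p.eval y) x = (Polynomial.derivative^[m] p).eval x := by
  induction m generalizing p with
  | zero => simp
  | succ m ih =>
    have hderiv : deriv (fun y => p.eval y) = fun y => p.derivative.eval y :=
      funext fun y => p.deriv
    rw [iteratedDeriv_succ', hderiv, ih, Function.iterate_succ_apply]

lemma taylorAtZero_polynomial (p : Polynomial ℂ) : taylorAtZero (fun q => p.eval q) = p := by
  ext m
  have hm : (m.factorial : ℂ) ≠ 0 := by exact_mod_cast m.factorial_ne_zero
  rw [taylorAtZero, PowerSeries.coeff_mk, iteratedDeriv_polynomial_eval,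
    ← Polynomial.coeff_zero_eq_eval_zero, Polynomial.coeff_iterate_derivative, zero_add,
    Nat.descFactorial_self, nsmul_eq_mul, inv_mul_cancel_left₀ hm, Polynomial.coeff_coe]

lemma taylorAtZero_pow (hf : AnalyticAt ℂ f 0) (k : ℕ) :
    taylorAtZero (f ^ k) = taylorAtZero f ^ k := by
  induction k with
  | zero => simpa using! taylorAtZero_polynomial 1
  | succ k ih => rw [pow_succ, taylorAtZero_mul (hf.pow k) hf, ih, pow_succ]

lemma tendsto_coeff_taylorAtZero {ι : Type*} {l : Filter ι} {F : ι → ℂ → ℂ}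
    (h : TendstoLocallyUniformlyOn F f l (Metric.ball 0 1))
    (hF : ∀ i, DifferentiableOn ℂ (F i) (Metric.ball 0 1)) (m : ℕ) :
    Tendsto (fun i => PowerSeries.coeff m (taylorAtZero (F i))) l
      (𝓝 (PowerSeries.coeff m (taylorAtZero f))) := by
  simp only [taylorAtZero, PowerSeries.coeff_mk]
  refine Tendsto.const_mul _ ?_
  induction m generalizing F f with
  | zero => simpa using h.tendsto_at (Metric.mem_ball_self one_pos)
  | succ m ih =>
    simp only [iteratedDeriv_succ']
    exact ih (h.deriv (Eventually.of_forall hF) Metric.isOpen_ball)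
      fun i => (hF i).deriv Metric.isOpen_ball

open scoped PowerSeries.WithPiTopology in
lemma taylorAtZero_tprod_one_sub_pow :
    taylorAtZero (fun q => ∏' n : ℕ, (1 - q ^ (n + 1))) = eulerProduct := by
  have hanalytic :=
    ModularForm.multipliableLocallyUniformlyOn_one_sub_pow.hasProdLocallyUniformlyOn
  have hformal : HasProd (fun m : ℕ => (1 - PowerSeries.X ^ (m + 1) : PowerSeries ℂ))
      eulerProduct := (PowerSeries.WithPiTopology.multipliable_one_sub_X_pow ℂ).hasProd
  rw [HasProd, PowerSeries.WithPiTopology.tendsto_iff_coeff_tendsto] at hformal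
  ext m
  refine tendsto_nhds_unique (tendsto_coeff_taylorAtZero hanalytic
    (fun s => DifferentiableOn.fun_finsetProd fun _ _ => by fun_prop) m)
    ((hformal m).congr fun s => ?_)
  have hpartial := taylorAtZero_polynomial (∏ n ∈ s, (1 - Polynomial.X ^ (n + 1)))
  simp only [Polynomial.eval_prod, Polynomial.eval_sub, Polynomial.eval_one, Polynomial.eval_pow,
    Polynomial.eval_X] at hpartial
  rw [hpartial, ← Polynomial.coeToPowerSeries.ringHom_apply,
    map_prod Polynomial.coeToPowerSeries.ringHom]
  simp

lemma qExpansion_discriminant :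
    qExpansion 1 ModularForm.discriminant = PowerSeries.X * eulerProduct ^ 24 := by
  have hanalytic : AnalyticAt ℂ (fun q : ℂ => ∏' n : ℕ, (1 - q ^ (n + 1))) 0 :=
    ModularForm.differentiableOn_tprod_one_sub_pow.analyticAt (Metric.ball_mem_nhds 0 one_pos)
  have hcusp : cuspFunction 1 ModularForm.discriminant =ᶠ[𝓝 0]
      (fun q : ℂ => q)
        * (fun q : ℂ => ∏' n : ℕ, (1 - q ^ (n + 1))) ^ 24 := by
    filter_upwards [Metric.ball_mem_nhds (0 : ℂ) one_pos] with q hq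
    rw [ModularForm.discriminant_cuspFunction_eqOn hq]
    simp only [Pi.mul_apply, Pi.pow_apply]
    rw [(ModularForm.multipliable_one_sub_pow (by simpa using hq)).tprod_pow]
  have hid : taylorAtZero (fun q => q) = PowerSeries.X := by
    simpa using taylorAtZero_polynomial Polynomial.X
  calc qExpansion 1 ModularForm.discriminant
      = taylorAtZero (cuspFunction 1 ModularForm.discriminant) := rfl
    _ = PowerSeries.X * eulerProduct ^ 24 := by
      rw [taylorAtZero_congr hcusp, taylorAtZero_mul (by fun_prop) (hanalytic.pow 24),
        hid, taylorAtZero_pow hanalytic, taylorAtZero_tprod_one_sub_pow]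

end TaylorSeries

section EulerOperator

variable {R : Type*} [CommRing R]

/-- The Euler operator `q d/dq` on power series in `q`. -/
def qDeriv : Derivation R (PowerSeries R) (PowerSeries R) :=
  (PowerSeries.X : PowerSeries R) • PowerSeries.derivative R

lemma qDeriv_apply (P : PowerSeries R) :
    qDeriv P = PowerSeries.X * PowerSeries.derivative R P := rfl

lemma coeff_qDeriv (P : PowerSeries R) (m : ℕ) :
    PowerSeries.coeff m (qDeriv P) = m * PowerSeries.coeff m P := by
  rcases m with _ | m
  · simp [qDeriv_apply]
  · rw [qDeriv_apply, PowerSeries.coeff_succ_X_mul, PowerSeries.coeff_derivative]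
    push_cast
    ring

lemma constantCoeff_qDeriv (P : PowerSeries R) : PowerSeries.constantCoeff (qDeriv P) = 0 := by
  simp [qDeriv_apply]

lemma qDeriv_mul (P Q : PowerSeries R) : qDeriv (P * Q) = P * qDeriv Q + Q * qDeriv P := by
  simp [Derivation.leibniz]

lemma qDeriv_pow_succ (P : PowerSeries R) (n : ℕ) :
    qDeriv (P ^ (n + 1)) = (n + 1) * P ^ n * qDeriv P := by
  simp [Derivation.leibniz_pow, mul_assoc]

lemma qDeriv_ofNat (n : ℕ) [n.AtLeastTwo] :
    qDeriv (ofNat(n) : PowerSeries R) = 0 := by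
  simpa only [Nat.cast_ofNat] using qDeriv.map_natCast (OfNat.ofNat n)

lemma qDeriv_X : qDeriv (PowerSeries.X : PowerSeries R) = PowerSeries.X := by
  simp [qDeriv_apply]

/-- Abel's identity: `u a² D t` is the Wronskian of `a` and `a t` under the second order operator
`D (u D ·) - r` with `D = q d/dq`. -/
lemma qDeriv_wronskian (u r a t : PowerSeries R) :
    qDeriv (u * a ^ 2 * qDeriv t)
      = a * (qDeriv (u * qDeriv (a * t)) - r * (a * t))
        - a * t * (qDeriv (u * qDeriv a) - r * a) := by
  simp only [qDeriv_mul, map_add, pow_two]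
  ring

lemma coeff_mul_of_coeff_lt_eq_zero {s : PowerSeries R} {n : ℕ}
    (hs : ∀ m < n, PowerSeries.coeff m s = 0) (u : PowerSeries R) :
    PowerSeries.coeff n (u * s) = PowerSeries.constantCoeff u * PowerSeries.coeff n s := by
  rw [PowerSeries.coeff_mul, Finset.sum_eq_single (0, n)]
  · simp
  · rintro ⟨i, j⟩ hij hne
    rw [Finset.HasAntidiagonal.mem_antidiagonal] at hij
    have hj : j < n := by
      rcases Nat.eq_zero_or_pos i with rfl | hi
      · exact absurd (by simp [← hij]) hne
      · lia
    simp [hs j hj]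
  · simp

variable [IsDomain R] [CharZero R]

/-- The indicial equation at `q = 0` is `u(0) ρ² = 0`, and the solution with `ρ = 0` is determined
by its constant term. -/
lemma eq_zero_of_qDeriv_qDeriv {u v w s : PowerSeries R}
    (h : u * qDeriv (qDeriv s) = v * qDeriv s + w * s)
    (hu : PowerSeries.constantCoeff u ≠ 0) (hv : PowerSeries.constantCoeff v = 0)
    (hw : PowerSeries.constantCoeff w = 0) (hs : PowerSeries.constantCoeff s = 0) : s = 0 := by
  ext n
  induction n using Nat.strong_induction_on with
  | _ n ih =>
    rcases Nat.eq_zero_or_pos n with rfl | hn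
    · simpa using hs
    have hcoeff := congrArg (PowerSeries.coeff n) h
    have hs' : ∀ m < n, PowerSeries.coeff m (qDeriv s) = 0 := fun m hm => by
      simp [coeff_qDeriv, ih m hm]
    have hs'' : ∀ m < n, PowerSeries.coeff m (qDeriv (qDeriv s)) = 0 := fun m hm => by
      simp [coeff_qDeriv (qDeriv s), hs' m hm]
    rw [map_add, coeff_mul_of_coeff_lt_eq_zero hs'', coeff_mul_of_coeff_lt_eq_zero hs',
      coeff_mul_of_coeff_lt_eq_zero fun m hm => by simpa using ih m hm, hv, hw, zero_mul, zero_mul,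
      add_zero, coeff_qDeriv, coeff_qDeriv] at hcoeff
    simpa [hu, hn.ne'] using hcoeff

lemma eq_of_mul_qDeriv_eq_mul {r s u w : PowerSeries R} (hr : u * qDeriv r = w * r)
    (hs : u * qDeriv s = w * s) (hu : PowerSeries.constantCoeff u ≠ 0)
    (hw : PowerSeries.constantCoeff w = 0)
    (h0 : PowerSeries.constantCoeff r = PowerSeries.constantCoeff s) : r = s := by
  have hd : u * qDeriv (r - s) = w * (r - s) := by rw [map_sub, mul_sub, hr, hs, mul_sub]
  have hdd := congrArg qDeriv hd
  rw [qDeriv_mul, qDeriv_mul] at hdd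
  refine sub_eq_zero.mp (eq_zero_of_qDeriv_qDeriv (u := u) (v := w - qDeriv u) (w := qDeriv w)
    ?_ hu ?_ (constantCoeff_qDeriv w) (by rw [map_sub, h0, sub_self]))
  · linear_combination hdd
  · rw [map_sub, hw, constantCoeff_qDeriv, sub_zero]

lemma eq_of_qDeriv_eq {r s : PowerSeries R} (h : qDeriv r = qDeriv s)
    (h0 : PowerSeries.constantCoeff r = PowerSeries.constantCoeff s) : r = s := by
  have hd : qDeriv (r - s) = 0 := by rw [map_sub, h, sub_self]
  exact sub_eq_zero.mp (eq_of_mul_qDeriv_eq_mul (u := 1) (w := 0) (by simp [hd]) (by simp)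
    (by simp) (by simp) (by simp [h0]))

end EulerOperator

section PowerSeriesRoots

lemma exists_pow_eq_of_constantCoeff_eq_one {R : Type*} [CommRing R] [Algebra ℚ R]
    {P : PowerSeries R} (hP : PowerSeries.constantCoeff P = 1) {n : ℕ} (hn : n ≠ 0) :
    ∃ A : PowerSeries R, A ^ n = P ∧ PowerSeries.constantCoeff A = 1 := by
  have hP1 : PowerSeries.constantCoeff (P - 1) = 0 := by simp [hP]
  have hsubst : PowerSeries.HasSubst (P - 1) := .of_constantCoeff_zero' hP1
  have hpow (k : ℕ) : PowerSeries.binomialSeries R (1 / n : ℚ) ^ k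
      = PowerSeries.binomialSeries R (k / n : ℚ) := by
    induction k with
    | zero => simp
    | succ k ih => rw [pow_succ, ih, ← PowerSeries.binomialSeries_add]; congr 1; push_cast; ring
  have hroot : PowerSeries.binomialSeries R (1 / n : ℚ) ^ n = 1 + PowerSeries.X := by
    rw [hpow, div_self (by exact_mod_cast hn)]
    simpa using PowerSeries.binomialSeries_nat (R := ℚ) (A := R) 1
  refine ⟨(PowerSeries.binomialSeries R (1 / n : ℚ)).subst (P - 1), ?_, ?_⟩
  · rw [← PowerSeries.subst_pow hsubst, hroot, PowerSeries.subst_add hsubst,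
      PowerSeries.subst_X hsubst, ← PowerSeries.coe_substAlgHom hsubst, map_one,
      add_sub_cancel]
  · have h0 := PowerSeries.constantCoeff_subst_eq_zero hP1
      (PowerSeries.binomialSeries R (1 / n : ℚ) - 1) (by simp)
    rw [← PowerSeries.coe_substAlgHom hsubst, map_sub, map_one, map_sub, map_one,
      sub_eq_zero] at h0
    rwa [← PowerSeries.coe_substAlgHom hsubst]

lemma aeval_powerSeries_injective {R : Type*} [CommRing R] [IsDomain R] {a : PowerSeries R}
    (ha : a ≠ 0) (ha0 : PowerSeries.constantCoeff a = 0) :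
    Function.Injective (Polynomial.aeval a : Polynomial R → PowerSeries R) := by
  rw [injective_iff_map_eq_zero]
  intro p hp
  by_contra hp0
  obtain ⟨q, hpq, hq⟩ := Polynomial.exists_eq_pow_rootMultiplicity_mul_and_not_dvd p hp0 0
  rw [map_zero, sub_zero, Polynomial.X_dvd_iff] at hq
  rw [map_zero, sub_zero] at hpq
  rw [hpq, map_mul, map_pow, Polynomial.aeval_X] at hp
  have hconst := congrArg PowerSeries.constantCoeff ((mul_eq_zero.mp hp).resolve_left
    (pow_ne_zero _ ha))
  rw [Polynomial.aeval_def, Polynomial.hom_eval₂, ha0, Polynomial.eval₂_at_zero] at hconst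
  exact hq (by simpa using hconst)

end PowerSeriesRoots

section QExpansions

open Filter Topology UpperHalfPlane
open scoped Manifold ModularForm

/-- `f` is holomorphic on the upper half plane and is given by the power series `P` in
`q = exp (2πiτ)`. Unlike `qExpansion 1 f = P`, this records the convergence to `f`. -/
structure HasQExpansion (f : ℍ → ℂ) (P : PowerSeries ℂ) : Prop where
  holo : MDiff f
  hasSum : ∀ τ : ℍ, HasSum (fun m : ℕ => PowerSeries.coeff m P
    • Function.Periodic.qParam (1 : ℝ) τ ^ m) (f τ)

namespace HasQExpansion

variable {f h : ℍ → ℂ} {P Q : PowerSeries ℂ}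

lemma bounded (hf : HasQExpansion f P) : IsBoundedAtImInfty f :=
  isBoundedAtImInfty_of_hasSum_qExpansion one_pos hf.hasSum

lemma periodic (hf : HasQExpansion f P) : Function.Periodic (f ∘ ofComplex) (1 : ℝ) := by
  intro w
  by_cases! hw : 0 < w.im
  · have hw' : 0 < (w + (1 : ℝ)).im := by simpa using hw
    simp only [Function.comp_apply, ofComplex_apply_of_im_pos hw', ofComplex_apply_of_im_pos hw]
    have hsum := hf.hasSum ⟨w + (1 : ℝ), hw'⟩
    have hparam : Function.Periodic.qParam (1 : ℝ) (w + (1 : ℝ))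
        = Function.Periodic.qParam (1 : ℝ) w := by
      simp [Function.Periodic.qParam, mul_add, Complex.exp_add]
    simp only [hparam] at hsum
    exact hsum.unique (hf.hasSum ⟨w, hw⟩)
  · have hw' : (w + (1 : ℝ)).im ≤ 0 := by simpa using hw
    exact congrArg f (ofComplex_apply_eq_of_im_nonpos hw' hw)

lemma analyticAt (hf : HasQExpansion f P) : AnalyticAt ℂ (cuspFunction 1 f) 0 :=
  analyticAt_cuspFunction_zero one_pos hf.periodic hf.holo hf.bounded

lemma qExpansion_eq (hf : HasQExpansion f P) : qExpansion 1 f = P := by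
  ext m
  have hseries :=
    (hasFPowerSeriesOnBall_cuspFunction one_pos hf.analyticAt hf.hasSum).hasFPowerSeriesAt
  have hcoeff := congrArg (FormalMultilinearSeries.coeff · m)
    (hseries.eq_formalMultilinearSeries hf.analyticAt.hasFPowerSeriesAt)
  simp only [FormalMultilinearSeries.coeff_ofScalars] at hcoeff
  rw [qExpansion_coeff, hcoeff, div_eq_inv_mul]

lemma of_bounded (hper : Function.Periodic (f ∘ ofComplex) (1 : ℝ)) (hholo : MDiff f)
    (hbdd : IsBoundedAtImInfty f) : HasQExpansion f (qExpansion 1 f) :=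
  ⟨hholo, hasSum_qExpansion one_pos hper hholo hbdd⟩

lemma of_modularForm {k : ℤ} (M : ModularForm 𝒮ℒ k) : HasQExpansion M (qExpansion 1 M) :=
  have : Fact (IsCusp OnePoint.infty 𝒮ℒ) :=
    ⟨Subgroup.isCusp_of_mem_strictPeriods one_pos one_mem_strictPeriods_SL⟩
  of_bounded (SlashInvariantFormClass.periodic_comp_ofComplex M one_mem_strictPeriods_SL)
    (ModularFormClass.holo M) (ModularFormClass.bdd_at_infty M)

lemma add (hf : HasQExpansion f P) (hh : HasQExpansion h Q) : HasQExpansion (f + h) (P + Q) :=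
  ⟨hf.holo.add hh.holo, fun τ => by
    simpa [add_mul] using (hf.hasSum τ).add (hh.hasSum τ)⟩

lemma smul (c : ℂ) (hf : HasQExpansion f P) : HasQExpansion (c • f) (c • P) :=
  ⟨hf.holo.const_smul c, fun τ => by
    simpa [mul_assoc] using (hf.hasSum τ).mul_left c⟩

lemma mul (hf : HasQExpansion f P) (hh : HasQExpansion h Q) : HasQExpansion (f * h) (P * Q) := by
  have hmul := of_bounded (f := f * h) (hf.periodic.mul hh.periodic) (hf.holo.mul hh.holo)
    (hf.bounded.mul hh.bounded)
  rwa [qExpansion_mul hf.analyticAt hh.analyticAt, hf.qExpansion_eq, hh.qExpansion_eq] at hmul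

lemma differentiableOn (hf : HasQExpansion f P) :
    DifferentiableOn ℂ (cuspFunction 1 f) (Metric.ball 0 1) :=
  differentiableOn_cuspFunction_ball one_pos hf.periodic hf.holo hf.bounded

end HasQExpansion

lemma hasDerivAt_qParam_one (w : ℂ) : HasDerivAt (Function.Periodic.qParam (1 : ℝ))
    (2 * Real.pi * Complex.I * Function.Periodic.qParam (1 : ℝ) w) w := by
  have hexp := ((hasDerivAt_id w).const_mul (2 * Real.pi * Complex.I : ℂ)).cexp
  convert! hexp using 1
  · ext z
    simp [Function.Periodic.qParam]
  · simp [Function.Periodic.qParam, mul_comm]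

lemma qParam_one_mem_ball (τ : ℍ) :
    Function.Periodic.qParam (1 : ℝ) τ ∈ Metric.ball (0 : ℂ) 1 := by
  simpa using Function.Periodic.norm_qParam_lt_one (h := 1) one_pos τ.im_pos

namespace HasQExpansion

variable {f h : ℍ → ℂ} {P Q : PowerSeries ℂ}

lemma normalizedDeriv_apply (hf : HasQExpansion f P) (τ : ℍ) :
    Derivative.normalizedDerivOfComplex f τ = Function.Periodic.qParam (1 : ℝ) τ
      * deriv (cuspFunction 1 f) (Function.Periodic.qParam (1 : ℝ) τ) := by
  have hlocal : f ∘ ofComplex =ᶠ[𝓝 (τ : ℂ)]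
      cuspFunction 1 f ∘ Function.Periodic.qParam (1 : ℝ) := by
    filter_upwards [isOpen_upperHalfPlaneSet.mem_nhds τ.im_pos] with w hw
    simpa only [Function.comp_apply, ofComplex_apply_of_im_pos hw] using
      (eq_cuspFunction (f := f) ⟨w, hw⟩ one_ne_zero hf.periodic).symm
  have hcusp := (hf.differentiableOn.differentiableAt
    (Metric.isOpen_ball.mem_nhds (qParam_one_mem_ball τ))).hasDerivAt
  have hpi : (2 * Real.pi * Complex.I : ℂ) ≠ 0 := Complex.two_pi_I_ne_zero
  rw [Derivative.normalizedDerivOfComplex, hlocal.deriv_eq,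
    (hcusp.comp (τ : ℂ) (hasDerivAt_qParam_one τ)).deriv]
  field_simp

lemma normalizedDeriv (hf : HasQExpansion f P) :
    HasQExpansion (Derivative.normalizedDerivOfComplex f) (qDeriv P) := by
  refine ⟨Derivative.normalizedDerivOfComplex_mdifferentiable hf.holo, fun τ => ?_⟩
  have htaylor := Complex.hasSum_taylorSeries_on_ball
    (hf.differentiableOn.deriv Metric.isOpen_ball) (qParam_one_mem_ball τ)
  rw [hf.normalizedDeriv_apply, ← hasSum_nat_add_iff' 1]
  convert! htaylor.mul_left (Function.Periodic.qParam (1 : ℝ) τ) using 1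
  · ext m
    rw [coeff_qDeriv, ← hf.qExpansion_eq, qExpansion_coeff, iteratedDeriv_succ']
    have hm : (m.factorial : ℂ) ≠ 0 := by exact_mod_cast m.factorial_ne_zero
    have hm' : ((m : ℂ) + 1) ≠ 0 := by exact_mod_cast m.succ_ne_zero
    simp only [Nat.factorial_succ, sub_zero, smul_eq_mul]
    push_cast
    field_simp
    ring
  · simp [coeff_qDeriv]

lemma isLevelOneForm {k : ℤ} (hf : HasQExpansion f P) (hk : ∀ γ : SL(2, ℤ), f ∣[k] γ = f) :
    IsLevelOneForm k P :=
  ⟨{ toFun := f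
     slash_action_eq' := fun _ ⟨γ, hγ⟩ => hγ ▸ hk γ
     holo' := hf.holo
     bdd_at_cusps' := fun {c} hc => by
        rw [Subgroup.IsArithmetic.isCusp_iff_isCusp_SL2Z] at hc
        rw [OnePoint.isBoundedAt_iff_forall_SL2Z hc]
        intro γ _
        rw [hk γ]
        exact hf.bounded }, hf.qExpansion_eq⟩

end HasQExpansion

namespace IsLevelOneForm

variable {v w : ℤ} {P Q : PowerSeries ℂ}

lemma smul (c : ℂ) (hP : IsLevelOneForm w P) : IsLevelOneForm w (c • P) := by
  obtain ⟨M, rfl⟩ := hP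
  exact ⟨c • M, ModularForm.qExpansion_smul one_pos one_mem_strictPeriods_SL c M⟩

lemma add (hP : IsLevelOneForm w P) (hQ : IsLevelOneForm w Q) : IsLevelOneForm w (P + Q) := by
  obtain ⟨M, rfl⟩ := hP
  obtain ⟨N, rfl⟩ := hQ
  exact ⟨M + N, ModularForm.qExpansion_add one_pos one_mem_strictPeriods_SL M N⟩

lemma zero (w : ℤ) : IsLevelOneForm w 0 := ⟨0, qExpansion_zero 1⟩

lemma one : IsLevelOneForm 0 1 := ⟨1, ModularForm.qExpansion_one⟩

lemma mul (hP : IsLevelOneForm v P) (hQ : IsLevelOneForm w Q) :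
    IsLevelOneForm (v + w) (P * Q) := by
  obtain ⟨M, rfl⟩ := hP
  obtain ⟨N, rfl⟩ := hQ
  exact ⟨M.mul N, ModularForm.qExpansion_mul one_pos one_mem_strictPeriods_SL M N⟩

lemma pow (hP : IsLevelOneForm w P) (n : ℕ) : IsLevelOneForm (n * w) (P ^ n) := by
  induction n with
  | zero => simpa using one
  | succ n ih =>
    rw [pow_succ, show ((n + 1 : ℕ) : ℤ) * w = n * w + w by push_cast; ring]
    exact ih.mul hP

lemma eq_of_lt_twelve (hP : IsLevelOneForm w P) (hQ : IsLevelOneForm w Q) (hw : w < 12)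
    (h0 : PowerSeries.constantCoeff P = PowerSeries.constantCoeff Q) : P = Q := by
  obtain ⟨M, hM⟩ := hP.add (hQ.smul (-1))
  have hsturm : M = 0 := by
    refine ModularForm.sturm_bound_levelOne ?_
    rw [Nat.div_eq_of_lt (by lia), hM]
    simp [pos_iff_ne_zero, PowerSeries.order_ne_zero_iff_constCoeff_eq_zero, h0]
  rw [hsturm] at hM
  have hsub : 0 = P + (-1 : ℂ) • Q := (qExpansion_zero 1).symm.trans hM
  rwa [neg_one_smul, ← sub_eq_add_neg, eq_comm, sub_eq_zero] at hsub

lemma eq_zero_of_neg (hP : IsLevelOneForm w P) (hw : w < 0) : P = 0 := by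
  obtain ⟨M, rfl⟩ := hP
  rw [ModularFormClass.levelOne_neg_weight_eq_zero hw M]
  exact qExpansion_zero 1

end IsLevelOneForm

end QExpansions

section Ramanujan

open Filter Topology UpperHalfPlane Derivative
open scoped Manifold ModularForm

/-- The `q`-expansion of the quasimodular Eisenstein series `E₂`. -/
def qE2 : PowerSeries ℂ :=
  PowerSeries.mk fun m => if m = 0 then 1 else -24 * (ArithmeticFunction.sigma 1 m : ℂ)

/-- The `q`-expansion of the Eisenstein series `E₄`. -/
def qE4 : PowerSeries ℂ := qExpansion 1 ModularForm.E₄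

/-- The `q`-expansion of the Eisenstein series `E₆`. -/
def qE6 : PowerSeries ℂ := qExpansion 1 ModularForm.E₆

/-- The `q`-expansion of the discriminant `Δ = η²⁴`. -/
def qDelta : PowerSeries ℂ := PowerSeries.X * eulerProduct ^ 24

lemma constantCoeff_qE2 : PowerSeries.constantCoeff qE2 = 1 := by
  rw [← PowerSeries.coeff_zero_eq_constantCoeff_apply]; simp [qE2]

lemma constantCoeff_qE4 : PowerSeries.constantCoeff qE4 = 1 := by
  rw [← PowerSeries.coeff_zero_eq_constantCoeff_apply]
  exact EisensteinSeries.E_qExpansion_coeff_zero _ ⟨2, rfl⟩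

lemma constantCoeff_qE6 : PowerSeries.constantCoeff qE6 = 1 := by
  rw [← PowerSeries.coeff_zero_eq_constantCoeff_apply]
  exact EisensteinSeries.E_qExpansion_coeff_zero _ ⟨3, rfl⟩

lemma hasQExpansion_E2 : HasQExpansion EisensteinSeries.E2 qE2 :=
  ⟨E2_mdifferentiable, fun τ => by
    simpa only [qE2, PowerSeries.coeff_mk, Function.Periodic.qParam, Complex.ofReal_one, div_one]
      using EisensteinSeries.hasSum_qExpansion_E2 (z := τ)⟩

lemma isLevelOneForm_qE4 : IsLevelOneForm 4 qE4 := ⟨ModularForm.E₄, rfl⟩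

lemma isLevelOneForm_qE6 : IsLevelOneForm 6 qE6 := ⟨ModularForm.E₆, rfl⟩

lemma isLevelOneForm_qDelta : IsLevelOneForm 12 qDelta :=
  ⟨CuspForm.discriminant, qExpansion_discriminant⟩

lemma ofNat_smul_powerSeries {R : Type*} [CommRing R] (n : ℕ) [n.AtLeastTwo]
    (P : PowerSeries R) : (ofNat(n) : R) • P = ofNat(n) * P := by
  rw [PowerSeries.smul_eq_C_mul, map_ofNat]

lemma qE4_pow_sub_qE6_pow : qE4 ^ 3 - qE6 ^ 2 = 1728 * qDelta := by
  have hforms : (⇑(ModularForm.E₄.pow 3) - ⇑(ModularForm.E₆.pow 2) : ℍ → ℂ)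
      = (1728 : ℂ) • ⇑CuspForm.discriminant := by
    ext z
    simp only [ModularForm.coe_pow, Pi.sub_apply, Pi.pow_apply, Pi.smul_apply,
      CuspForm.coe_discriminant, smul_eq_mul, ModularForm.discriminant_eq_E₄_cube_sub_E₆_sq z]
    ring
  have hexp := congrArg (qExpansion 1) hforms
  rwa [ModularForm.qExpansion_sub one_pos one_mem_strictPeriods_SL,
    ModularForm.qExpansion_smul one_pos one_mem_strictPeriods_SL,
    ModularForm.qExpansion_pow one_pos one_mem_strictPeriods_SL,
    ModularForm.qExpansion_pow one_pos one_mem_strictPeriods_SL,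
    CuspForm.coe_discriminant, qExpansion_discriminant, ofNat_smul_powerSeries] at hexp

lemma HasQExpansion.serreDerivative {f : ℍ → ℂ} {P : PowerSeries ℂ} (hf : HasQExpansion f P)
    (k : ℂ) : HasQExpansion (serreDerivative k f) (qDeriv P - (k / 12) • (qE2 * P)) := by
  have hsum := hf.normalizedDeriv.add ((hasQExpansion_E2.mul hf).smul (-(k / 12)))
  convert! hsum using 1
  · ext z
    simp
    ring
  · module

lemma IsLevelOneForm.serreDerivative {k : ℤ} {P : PowerSeries ℂ} (hP : IsLevelOneForm k P) :
    IsLevelOneForm (k + 2) (qDeriv P - ((k : ℂ) / 12) • (qE2 * P)) := by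
  obtain ⟨M, rfl⟩ := hP
  have hM := HasQExpansion.of_modularForm M
  exact (hM.serreDerivative k).isLevelOneForm fun γ =>
    serreDerivative_slash_invariant hM.holo (M.slash_action_eq' _ ⟨γ, rfl⟩)

lemma hasDerivAt_D2 (γ : SL(2, ℤ)) (z : ℍ) : HasDerivAt (EisensteinSeries.D2 γ ∘ ofComplex)
    (-(2 * Real.pi * Complex.I)⁻¹ * EisensteinSeries.D2 γ z ^ 2) z := by
  let g : GL (Fin 2) ℝ := γ
  have hlocal : EisensteinSeries.D2 γ ∘ ofComplex =ᶠ[𝓝 (z : ℂ)]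
      fun w => 2 * Real.pi * Complex.I * γ 1 0 * denom g w ^ (-1 : ℤ) := by
    filter_upwards [isOpen_upperHalfPlaneSet.mem_nhds z.im_pos] with w hw
    simp only [Function.comp_apply, EisensteinSeries.D2, ofComplex_apply_of_im_pos hw,
      zpow_neg_one, div_eq_mul_inv]
    rfl
  refine HasDerivAt.congr_of_eventuallyEq ?_ hlocal
  convert! (hasDerivAt_denom_zpow g (-1) z).const_mul (2 * Real.pi * Complex.I * γ 1 0 : ℂ) using 1
  have hdenom : denom g z ≠ 0 := denom_ne_zero g z
  have hentry : ((g 1 0 : ℝ) : ℂ) = γ 1 0 := by simp [g]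
  have hpi : (2 * Real.pi * Complex.I : ℂ) ≠ 0 := Complex.two_pi_I_ne_zero
  rw [hentry, show (-1 - 1 : ℤ) = -2 by norm_num, zpow_neg]
  change -(2 * Real.pi * Complex.I : ℂ)⁻¹
    * (2 * Real.pi * Complex.I * γ 1 0 / denom g z) ^ 2 = _
  push_cast
  field_simp

lemma mdifferentiable_D2 (γ : SL(2, ℤ)) : MDiff (EisensteinSeries.D2 γ) := fun z =>
  mdifferentiableAt_iff.mpr (hasDerivAt_D2 γ z).differentiableAt

lemma normalizedDeriv_D2 (γ : SL(2, ℤ)) : normalizedDerivOfComplex (EisensteinSeries.D2 γ)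
    = (1 / (24 * riemannZeta 2)) • EisensteinSeries.D2 γ ^ 2 := by
  ext z
  have hpi : (Real.pi : ℂ) ≠ 0 := by exact_mod_cast Real.pi_ne_zero
  rw [normalizedDerivOfComplex, (hasDerivAt_D2 γ z).deriv, riemannZeta_two]
  simp only [Pi.smul_apply, Pi.pow_apply, smul_eq_mul]
  field_simp
  linear_combination -24 * EisensteinSeries.D2 γ z ^ 2 * Complex.I_sq

/-- The anomaly of `E₂²` under `SL(2, ℤ)` is absorbed by that of the derivative of `E₂`, which is
why the parameter here is `1` and not the weight `2` of `E₂`. -/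
lemma serreDerivative_E2_slash (γ : SL(2, ℤ)) :
    serreDerivative 1 EisensteinSeries.E2 ∣[(4 : ℤ)] γ
      = serreDerivative 1 EisensteinSeries.E2 := by
  have hweight : serreDerivative 1 EisensteinSeries.E2
      = serreDerivative 2 EisensteinSeries.E2
        + (1 / 12 : ℂ) • (EisensteinSeries.E2 * EisensteinSeries.E2) := by
    ext z
    simp
    ring
  have hslash := EisensteinSeries.E2_slash_action γ
  have hsq := ModularForm.mul_slash_SL2 2 2 γ EisensteinSeries.E2 EisensteinSeries.E2
  have hserre := serreDerivative_slash_equivariant (k := 2) E2_mdifferentiable (γ := γ)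
  rw [hslash, serreDerivative_sub _ _ _ E2_mdifferentiable ((mdifferentiable_D2 γ).const_smul _),
    serreDerivative_smul _ _ _ (mdifferentiable_D2 γ)] at hserre
  rw [hslash] at hsq
  norm_num only at hsq hserre
  rw [hweight, SlashAction.add_slash, ModularForm.SL_smul_slash, hsq, hserre]
  ext z
  simp [normalizedDeriv_D2]
  ring

lemma isLevelOneForm_serreDerivative_E2 :
    IsLevelOneForm 4 (qDeriv qE2 - (1 / 12 : ℂ) • (qE2 * qE2)) :=
  (hasQExpansion_E2.serreDerivative 1).isLevelOneForm serreDerivative_E2_slash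

lemma qDeriv_qE2 : 12 * qDeriv qE2 = qE2 ^ 2 - qE4 := by
  have h := isLevelOneForm_serreDerivative_E2.eq_of_lt_twelve
    (isLevelOneForm_qE4.smul (-(1 / 12))) (by norm_num)
    (by simp [constantCoeff_qDeriv, constantCoeff_qE2, constantCoeff_qE4])
  rw [← ofNat_smul_powerSeries, pow_two, sub_eq_iff_eq_add.mp h]
  module

lemma qDeriv_qE4 : 3 * qDeriv qE4 = qE2 * qE4 - qE6 := by
  have h := isLevelOneForm_qE4.serreDerivative.eq_of_lt_twelve
    (isLevelOneForm_qE6.smul (-(1 / 3))) (by norm_num)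
    (by simp [constantCoeff_qDeriv, constantCoeff_qE2, constantCoeff_qE4, constantCoeff_qE6]
        norm_num)
  push_cast at h
  rw [← ofNat_smul_powerSeries, sub_eq_iff_eq_add.mp h]
  module

lemma qDeriv_qE6 : 2 * qDeriv qE6 = qE2 * qE6 - qE4 ^ 2 := by
  have h := isLevelOneForm_qE6.serreDerivative.eq_of_lt_twelve
    ((isLevelOneForm_qE4.mul isLevelOneForm_qE4).smul (-(1 / 2))) (by norm_num)
    (by simp [constantCoeff_qDeriv, constantCoeff_qE2, constantCoeff_qE4, constantCoeff_qE6]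
        norm_num)
  push_cast at h
  rw [← ofNat_smul_powerSeries, pow_two, sub_eq_iff_eq_add.mp h]
  module

end Ramanujan

instance powerSeries_charZero {R : Type*} [CommRing R] [CharZero R] : CharZero (PowerSeries R) :=
  charZero_of_injective_ringHom PowerSeries.C_injective

section MirrorMap

/-- The fourth root of `E₄` with constant term `1`; it is the holomorphic period of the elliptic
fibre. -/
def rootE4 : PowerSeries ℂ :=
  (exists_pow_eq_of_constantCoeff_eq_one constantCoeff_qE4 four_ne_zero).choose

lemma rootE4_pow_four : rootE4 ^ 4 = qE4 :=
  (exists_pow_eq_of_constantCoeff_eq_one constantCoeff_qE4 four_ne_zero).choose_spec.1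

lemma constantCoeff_rootE4 : PowerSeries.constantCoeff rootE4 = 1 :=
  (exists_pow_eq_of_constantCoeff_eq_one constantCoeff_qE4 four_ne_zero).choose_spec.2

lemma rootE4_ne_zero : rootE4 ≠ 0 := fun h => by
  simpa [h] using constantCoeff_rootE4

/-- The inverse mirror map of the elliptic fibre, that is `z₁` on `z₂ = 0` as a power series in
`q_E`. -/
def mirrorMap : PowerSeries ℂ := (1 / 864 : ℂ) • (1 - qE6 * rootE4⁻¹ ^ 6)

lemma constantCoeff_mirrorMap : PowerSeries.constantCoeff mirrorMap = 0 := by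
  simp [mirrorMap, constantCoeff_qE6, constantCoeff_rootE4]

lemma qE6_eq : qE6 = rootE4 ^ 6 * (1 - 864 * mirrorMap) := by
  have hinv : rootE4 ^ 6 * rootE4⁻¹ ^ 6 = 1 := by
    rw [← mul_pow, PowerSeries.mul_inv_cancel _ (by simp [constantCoeff_rootE4]), one_pow]
  have hsmul : 864 * mirrorMap = 1 - qE6 * rootE4⁻¹ ^ 6 := by
    rw [← ofNat_smul_powerSeries, mirrorMap, smul_smul]
    norm_num
  linear_combination -qE6 * hinv + rootE4 ^ 6 * hsmul

lemma qDelta_eq : qDelta = rootE4 ^ 12 * (mirrorMap * (1 - 432 * mirrorMap)) := by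
  have h := qE4_pow_sub_qE6_pow
  rw [qE6_eq, ← rootE4_pow_four] at h
  refine mul_left_cancel₀ (OfNat.ofNat_ne_zero 1728) ?_
  linear_combination -h

lemma qDelta_ne_zero : qDelta ≠ 0 :=
  mul_ne_zero PowerSeries.X_ne_zero <| pow_ne_zero _ fun h => by
    simpa [h] using constantCoeff_eulerProduct

lemma mirrorMap_ne_zero : mirrorMap ≠ 0 := fun h => by
  simpa [h] using qDelta_ne_zero.symm.trans_eq qDelta_eq

lemma qDeriv_rootE4 :
    12 * qDeriv rootE4 = rootE4 * (qE2 - rootE4 ^ 2 * (1 - 864 * mirrorMap)) := by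
  have h := qDeriv_qE4
  rw [← rootE4_pow_four, qE6_eq, qDeriv_pow_succ] at h
  push_cast at h
  refine mul_left_cancel₀ (pow_ne_zero 3 rootE4_ne_zero) ?_
  linear_combination h

lemma qDeriv_mirrorMap :
    qDeriv mirrorMap = mirrorMap * ((1 - 432 * mirrorMap) * rootE4 ^ 2) := by
  have h := qDeriv_qE6
  rw [qE6_eq, qDeriv_mul, qDeriv_pow_succ, map_sub, qDeriv_mul, Derivation.map_one_eq_zero,
    qDeriv_ofNat, ← rootE4_pow_four] at h
  push_cast at h
  refine mul_left_cancel₀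
    (mul_ne_zero (OfNat.ofNat_ne_zero 1728) (pow_ne_zero 6 rootE4_ne_zero)) ?_
  linear_combination -h + rootE4 ^ 5 * (1 - 864 * mirrorMap) * qDeriv_rootE4

lemma qDeriv_one_sub_mirrorMap : qDeriv (1 - 432 * mirrorMap)
    = -(432 * mirrorMap * ((1 - 432 * mirrorMap) * rootE4 ^ 2)) := by
  rw [map_sub, Derivation.map_one_eq_zero, qDeriv_mul, qDeriv_ofNat, qDeriv_mirrorMap]
  ring

/-- The Picard–Fuchs equation of the elliptic fibre in the coordinate `q_E`, solved by
`E₄^(1/4)`. -/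
lemma qDeriv_qDeriv_rootE4 : rootE4 * qDeriv (qDeriv rootE4)
    = 2 * qDeriv rootE4 * qDeriv rootE4
      + 60 * (mirrorMap * (1 - 432 * mirrorMap)) * rootE4 ^ 5 * rootE4 := by
  have ha := qDeriv_rootE4
  have ht := qDeriv_mirrorMap
  have he := qDeriv_qE2
  have haa := congrArg qDeriv ha
  rw [← rootE4_pow_four] at he
  simp only [qDeriv_mul, qDeriv_ofNat, map_sub, Derivation.map_one_eq_zero,
    qDeriv_pow_succ rootE4 1] at haa
  push_cast at haa
  refine mul_left_cancel₀ (OfNat.ofNat_ne_zero 144) ?_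
  linear_combination 12 * rootE4 * haa + rootE4 ^ 2 * he + 10368 * rootE4 ^ 4 * ht
    - (rootE4 * qE2 + rootE4 ^ 3 * (1 - 864 * mirrorMap) + 24 * qDeriv rootE4) * ha

lemma qDeriv_qDelta : qDeriv qDelta = qE2 * qDelta := by
  rw [qDelta_eq, qDeriv_mul, qDeriv_mul, qDeriv_pow_succ, qDeriv_one_sub_mirrorMap,
    qDeriv_mirrorMap]
  push_cast
  linear_combination rootE4 ^ 11 * (mirrorMap * (1 - 432 * mirrorMap)) * qDeriv_rootE4

lemma qDeriv_eulerProduct : 24 * qDeriv eulerProduct = (qE2 - 1) * eulerProduct := by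
  have hE : eulerProduct ≠ 0 := fun h => by simpa [h] using constantCoeff_eulerProduct
  have h := qDeriv_qDelta
  rw [qDelta, qDeriv_mul, qDeriv_pow_succ, qDeriv_X] at h
  push_cast at h
  refine mul_left_cancel₀ (mul_ne_zero PowerSeries.X_ne_zero (pow_ne_zero 23 hE)) ?_
  linear_combination h

end MirrorMap

section Restriction

lemma hasSubst_mirrorMap : PowerSeries.HasSubst mirrorMap :=
  .of_constantCoeff_zero' constantCoeff_mirrorMap

/-- Substitution of the inverse mirror map for `z₁`. -/
def compMirror : PowerSeries ℂ →ₐ[ℂ] PowerSeries ℂ := PowerSeries.substAlgHom hasSubst_mirrorMap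

lemma compMirror_apply (P : PowerSeries ℂ) : compMirror P = PowerSeries.subst mirrorMap P := by
  rw [compMirror, PowerSeries.coe_substAlgHom]

lemma compMirror_X : compMirror PowerSeries.X = mirrorMap :=
  PowerSeries.substAlgHom_X hasSubst_mirrorMap

lemma constantCoeff_compMirror (P : PowerSeries ℂ) :
    PowerSeries.constantCoeff (compMirror P) = PowerSeries.constantCoeff P := by
  have h : PowerSeries.constantCoeff
      (compMirror (P - PowerSeries.C (PowerSeries.constantCoeff P))) = 0 := by
    rw [compMirror_apply]
    exact PowerSeries.constantCoeff_subst_eq_zero constantCoeff_mirrorMap _ (by simp)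
  have hC : compMirror (PowerSeries.C (PowerSeries.constantCoeff P))
      = PowerSeries.C (PowerSeries.constantCoeff P) := compMirror.commutes _
  rwa [map_sub, hC, map_sub, PowerSeries.constantCoeff_C, sub_eq_zero] at h

lemma qDeriv_compMirror (P : PowerSeries ℂ) :
    qDeriv (compMirror P) = compMirror (qDeriv P) * ((1 - 432 * mirrorMap) * rootE4 ^ 2) := by
  have h := qDeriv_mirrorMap
  rw [qDeriv_apply] at h
  rw [qDeriv_apply P, map_mul, compMirror_X, qDeriv_apply, compMirror_apply, compMirror_apply,
    PowerSeries.derivative_subst hasSubst_mirrorMap]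
  linear_combination PowerSeries.subst mirrorMap (PowerSeries.derivative ℂ P) * h

lemma compMirror_one_sub_X :
    compMirror (1 - 432 * PowerSeries.X) = 1 - 432 * mirrorMap := by
  rw [map_sub, map_one, map_mul, map_ofNat, compMirror_X]

lemma hasSubst_restrictBase :
    MvPowerSeries.HasSubst (![PowerSeries.X, 0] : Fin 2 → PowerSeries ℂ) :=
  MvPowerSeries.hasSubst_of_constantCoeff_zero fun i => by
    fin_cases i
    · exact PowerSeries.constantCoeff_X
    · exact map_zero _

/-- Restriction of a power series in two variables to the line on which the second variable is
`0`. -/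
def restrictBase : Series →ₐ[ℂ] PowerSeries ℂ := MvPowerSeries.substAlgHom hasSubst_restrictBase

lemma restrictBase_apply (G : Series) : restrictBase G
    = MvPowerSeries.subst (![PowerSeries.X, 0] : Fin 2 → PowerSeries ℂ) G := by
  rw [restrictBase, MvPowerSeries.coe_substAlgHom]

lemma restrictBase_X (i : Fin 2) :
    restrictBase (MvPowerSeries.X i) = (![PowerSeries.X, 0] : Fin 2 → PowerSeries ℂ) i :=
  MvPowerSeries.substAlgHom_X hasSubst_restrictBase i

lemma coeff_restrictBase (G : Series) (a : ℕ) :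
    PowerSeries.coeff a (restrictBase G) = MvPowerSeries.coeff (Finsupp.single 0 a) G := by
  have hprod (d : Fin 2 →₀ ℕ) :
      (d.prod fun i e => (![PowerSeries.X, 0] : Fin 2 → PowerSeries ℂ) i ^ e)
        = PowerSeries.X ^ d 0 * 0 ^ d 1 := by
    rw [Finsupp.prod_fintype _ _ (by simp), Fin.prod_univ_two]
    rfl
  have hcoeff (d : Fin 2 →₀ ℕ) :
      PowerSeries.coeff a (PowerSeries.X ^ d 0 * 0 ^ d 1 : PowerSeries ℂ)
        = if d = Finsupp.single 0 a then 1 else 0 := by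
    have hd : d = Finsupp.single 0 a ↔ a = d 0 ∧ d 1 = 0 := by
      simp [Finsupp.ext_iff, Fin.forall_fin_two, eq_comm]
    rcases eq_or_ne (d 1) 0 with h1 | h1
    · simp [hd, h1, PowerSeries.coeff_X_pow]
    · simp [hd, h1]
  rw [restrictBase_apply, PowerSeries.coeff, MvPowerSeries.coeff_subst hasSubst_restrictBase]
  refine (finsum_congr fun d =>
    congrArg (MvPowerSeries.coeff d G • ·) ((congrArg _ (hprod d)).trans (hcoeff d))).trans ?_
  rw [finsum_eq_single _ (Finsupp.single 0 a) fun d hd => by simp [hd]]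
  simp

lemma constantCoeff_restrictBase (G : Series) :
    PowerSeries.constantCoeff (restrictBase G) = MvPowerSeries.constantCoeff G := by
  rw [← PowerSeries.coeff_zero_eq_constantCoeff_apply, coeff_restrictBase]
  simp

/-- The Picard–Fuchs equation of the elliptic fibre for a solution
`A + B 0 * log z₁ + B 1 * log z₂`. -/
lemma restrictBase_PF1 {A : Series} {B : Fin 2 → Series} (h : PF1 (A, B) = 0) :
    qDeriv ((1 - 432 * PowerSeries.X) * qDeriv (restrictBase A))
        - 60 * PowerSeries.X * restrictBase A
      = 3 * qDeriv (restrictBase (B 1))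
        - qDeriv ((1 - 432 * PowerSeries.X) * restrictBase (B 0))
        - (1 - 432 * PowerSeries.X) * qDeriv (restrictBase (B 0)) := by
  have hofNat (n : ℕ) [n.AtLeastTwo] (P : PowerSeries ℂ) (m : ℕ) :
      PowerSeries.coeff m (ofNat(n) * P) = ofNat(n) * PowerSeries.coeff m P := by
    rw [← ofNat_smul_powerSeries, PowerSeries.coeff_smul, smul_eq_mul]
  simp only [sub_mul, one_mul, map_sub]
  ext a
  have hcoeff := PF1_apply_fst A B (Finsupp.single 0 a)
  rw [h] at hcoeff
  rcases a with _ | a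
  · simp [mul_assoc, constantCoeff_qDeriv]
  · have hpred : (Finsupp.single (0 : Fin 2) (a + 1) - Finsupp.single 0 1 : Fin 2 →₀ ℕ)
        = Finsupp.single 0 a := by
      rw [← Finsupp.single_tsub]; simp
    rw [hpred] at hcoeff
    simp only [Prod.fst_zero, MvPowerSeries.coeff_zero, Finsupp.single_eq_same, Nat.cast_add,
      Nat.cast_one, ne_eq, one_ne_zero, not_false_eq_true, Finsupp.single_eq_of_ne,
      CharP.cast_eq_zero, mul_zero, sub_zero, le_add_iff_nonneg_left, zero_le, ↓reduceIte,
      add_sub_cancel_right] at hcoeff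
    simp only [map_sub, mul_assoc, coeff_qDeriv, hofNat, PowerSeries.coeff_succ_X_mul,
      coeff_restrictBase]
    push_cast
    linear_combination -hcoeff

end Restriction

section Periods

lemma qDeriv_qDeriv_restrictBase_X0 :
    qDeriv ((1 - 432 * PowerSeries.X) * qDeriv (restrictBase X0))
      = 60 * PowerSeries.X * restrictBase X0 := by
  have h := restrictBase_PF1 isLargeVolumeBasis_frobenius.pf_zero.1
  simpa [sub_eq_zero] using h

lemma compMirror_restrictBase_X0 : compMirror (restrictBase X0) = rootE4 := by
  set s := compMirror (restrictBase X0)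
  set r := compMirror ((1 - 432 * PowerSeries.X) * qDeriv (restrictBase X0)) with hr
  have hs : qDeriv s = rootE4 ^ 2 * r := by
    rw [qDeriv_compMirror, hr, map_mul, compMirror_one_sub_X]
    ring
  have hode : rootE4 * qDeriv (qDeriv s) = 2 * qDeriv rootE4 * qDeriv s
      + 60 * (mirrorMap * (1 - 432 * mirrorMap)) * rootE4 ^ 5 * s := by
    rw [hs, qDeriv_mul, qDeriv_pow_succ _ 1, qDeriv_compMirror, qDeriv_qDeriv_restrictBase_X0,
      map_mul, map_mul, map_ofNat, compMirror_X]
    push_cast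
    ring
  refine sub_eq_zero.mp (eq_zero_of_qDeriv_qDeriv (u := rootE4) (v := 2 * qDeriv rootE4)
    (w := 60 * (mirrorMap * (1 - 432 * mirrorMap)) * rootE4 ^ 5) ?_ ?_ ?_ ?_ ?_)
  · rw [map_sub, map_sub]
    linear_combination hode - qDeriv_qDeriv_rootE4
  · simp [constantCoeff_rootE4]
  · simp [constantCoeff_qDeriv]
  · simp [constantCoeff_mirrorMap]
  · rw [map_sub, constantCoeff_compMirror, constantCoeff_restrictBase, constantCoeff_rootE4,
      isLargeVolumeBasis_frobenius.const_zero, sub_self]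

/-- The regular parts `S₁ / X₀` and `S₂ / X₀` of the flat coordinates `log q_E` and `log q_B`. -/
def flatExponent : Fin 2 → Series := ![S1 * X0⁻¹, S2 * X0⁻¹]

lemma constantCoeff_flatExponent (i : Fin 2) :
    MvPowerSeries.constantCoeff (flatExponent i) = 0 := by
  have h := isLargeVolumeBasis_frobenius
  fin_cases i
  · simp [flatExponent, h.const_one]
  · simp [flatExponent, h.const_two]

lemma flatUnit_eq (i : Fin 2) : flatUnit i = expSeries (flatExponent i) := by
  fin_cases i <;> rfl

lemma X0_mul_flatExponent (i : Fin 2) : X0 * flatExponent i = ![S1, S2] i := by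
  have hinv : X0 * X0⁻¹ = 1 :=
    MvPowerSeries.mul_inv_cancel _ (by simp [isLargeVolumeBasis_frobenius.const_zero])
  fin_cases i
  · change X0 * (S1 * X0⁻¹) = S1
    linear_combination S1 * hinv
  · change X0 * (S2 * X0⁻¹) = S2
    linear_combination S2 * hinv

lemma qDeriv_wronskian_restrictBase (i : Fin 2) :
    qDeriv ((1 - 432 * PowerSeries.X) * restrictBase X0 ^ 2
        * qDeriv (restrictBase (flatExponent i)))
      = restrictBase X0
        * (qDeriv ((1 - 432 * PowerSeries.X) * qDeriv (restrictBase (![S1, S2] i)))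
          - 60 * PowerSeries.X * restrictBase (![S1, S2] i)) := by
  rw [qDeriv_wronskian _ (60 * PowerSeries.X), qDeriv_qDeriv_restrictBase_X0, sub_self, mul_zero,
    sub_zero, ← map_mul, X0_mul_flatExponent]

lemma wronskian_zero : (1 - 432 * PowerSeries.X) * restrictBase X0 ^ 2
    * (1 + qDeriv (restrictBase (flatExponent 0))) = 1 := by
  have hS := restrictBase_PF1 isLargeVolumeBasis_frobenius.pf_one.1
  have hw := qDeriv_wronskian_restrictBase 0
  simp only [Matrix.cons_val_zero, Matrix.cons_val_one, map_zero, mul_zero, zero_sub] at hS hw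
  rw [hS, qDeriv_mul, qDeriv_mul _ (restrictBase X0)] at hw
  refine eq_of_qDeriv_eq ?_ ?_
  · rw [mul_add, mul_one, map_add, qDeriv_mul, qDeriv_pow_succ _ 1, qDeriv_mul, hw,
      Derivation.map_one_eq_zero]
    push_cast
    ring
  · simp [constantCoeff_restrictBase, isLargeVolumeBasis_frobenius.const_zero,
      constantCoeff_qDeriv]

lemma wronskian_one : 2 * ((1 - 432 * PowerSeries.X) * restrictBase X0 ^ 2
    * qDeriv (restrictBase (flatExponent 1))) = 3 * (restrictBase X0 ^ 2 - 1) := by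
  have hS := restrictBase_PF1 isLargeVolumeBasis_frobenius.pf_two.1
  have hw := qDeriv_wronskian_restrictBase 1
  simp only [Matrix.cons_val_zero, Matrix.cons_val_one, map_zero, mul_zero, sub_zero] at hS hw
  rw [hS] at hw
  refine eq_of_qDeriv_eq ?_ ?_
  · rw [qDeriv_mul, hw, qDeriv_ofNat, qDeriv_mul 3, qDeriv_ofNat, map_sub, qDeriv_pow_succ _ 1,
      Derivation.map_one_eq_zero]
    push_cast
    ring
  · simp [constantCoeff_restrictBase, isLargeVolumeBasis_frobenius.const_zero,
      constantCoeff_qDeriv]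

lemma restrictBase_expSeries {A : Series} (hA : MvPowerSeries.constantCoeff A = 0) :
    restrictBase (expSeries A) = PowerSeries.subst (restrictBase A) (PowerSeries.exp ℂ) := by
  rw [restrictBase_apply, restrictBase_apply, expSeries, PowerSeries.subst, PowerSeries.subst,
    MvPowerSeries.subst_comp_subst_apply
      (PowerSeries.HasSubst.of_constantCoeff_zero hA).const hasSubst_restrictBase]

lemma qDeriv_restrictBase_flatUnit (i : Fin 2) : qDeriv (restrictBase (flatUnit i))
    = restrictBase (flatUnit i) * qDeriv (restrictBase (flatExponent i)) := by
  have h0 := constantCoeff_flatExponent i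
  have hsubst : PowerSeries.HasSubst (restrictBase (flatExponent i)) :=
    .of_constantCoeff_zero' (by rw [constantCoeff_restrictBase, h0])
  rw [flatUnit_eq, restrictBase_expSeries h0, qDeriv_apply, qDeriv_apply,
    PowerSeries.derivative_subst hsubst, PowerSeries.derivative_exp]
  ring

/-- Restriction of a power series in `z₁, z₂` to `z₂ = 0`, written as a power series in `q_E`. -/
def flatRestriction : Series →ₐ[ℂ] PowerSeries ℂ := compMirror.comp restrictBase

lemma flatRestriction_apply (G : Series) :
    flatRestriction G = compMirror (restrictBase G) := rfl

lemma constantCoeff_flatRestriction (G : Series) :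
    PowerSeries.constantCoeff (flatRestriction G) = MvPowerSeries.constantCoeff G := by
  rw [flatRestriction_apply, constantCoeff_compMirror, constantCoeff_restrictBase]

lemma flatRestriction_X0 : flatRestriction X0 = rootE4 := compMirror_restrictBase_X0

lemma qDeriv_flatRestriction_flatUnit_zero : qDeriv (flatRestriction (flatUnit 0))
    = (1 - (1 - 432 * mirrorMap) * rootE4 ^ 2) * flatRestriction (flatUnit 0) := by
  have h := congrArg compMirror wronskian_zero
  simp only [map_mul, map_pow, compMirror_one_sub_X, compMirror_restrictBase_X0, map_add,
    map_one] at h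
  rw [flatRestriction_apply, qDeriv_compMirror, qDeriv_restrictBase_flatUnit, map_mul]
  linear_combination compMirror (restrictBase (flatUnit 0)) * h

lemma qDeriv_flatRestriction_flatUnit_one : 2 * qDeriv (flatRestriction (flatUnit 1))
    = 3 * (rootE4 ^ 2 - 1) * flatRestriction (flatUnit 1) := by
  have h := congrArg compMirror wronskian_one
  simp only [map_mul, map_pow, compMirror_X, compMirror_restrictBase_X0, map_sub, map_one,
    map_ofNat] at h
  rw [flatRestriction_apply, qDeriv_compMirror, qDeriv_restrictBase_flatUnit, map_mul]
  linear_combination compMirror (restrictBase (flatUnit 1)) * h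

lemma flatRestriction_flatUnit_zero : flatRestriction (flatUnit 0) * eulerProduct ^ 24
    = rootE4 ^ 12 * (1 - 432 * mirrorMap) := by
  refine eq_of_mul_qDeriv_eq_mul (u := 1)
    (w := qE2 - (1 - 432 * mirrorMap) * rootE4 ^ 2) ?_ ?_ ?_ ?_ ?_
  · rw [qDeriv_mul, qDeriv_pow_succ, qDeriv_flatRestriction_flatUnit_zero]
    push_cast
    linear_combination flatRestriction (flatUnit 0) * eulerProduct ^ 23 * qDeriv_eulerProduct
  · rw [qDeriv_mul, qDeriv_pow_succ, qDeriv_one_sub_mirrorMap]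
    push_cast
    linear_combination (1 - 432 * mirrorMap) * rootE4 ^ 11 * qDeriv_rootE4
  · simp
  · simp [constantCoeff_qE2, constantCoeff_mirrorMap, constantCoeff_rootE4]
  · simp [constantCoeff_flatRestriction, constantCoeff_flatUnit, constantCoeff_eulerProduct,
      constantCoeff_rootE4, constantCoeff_mirrorMap]

lemma mirrorMap_mul_flatRestriction_flatUnit_zero :
    mirrorMap * flatRestriction (flatUnit 0) = PowerSeries.X := by
  have hE : eulerProduct ≠ 0 := fun h => by simpa [h] using constantCoeff_eulerProduct
  have hΔ := qDelta_eq
  rw [qDelta] at hΔ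
  refine mul_right_cancel₀ (pow_ne_zero 24 hE) ?_
  linear_combination mirrorMap * flatRestriction_flatUnit_zero - hΔ

lemma flatRestriction_flatUnit_one : flatRestriction (flatUnit 1)
    * ((1 - 432 * mirrorMap) ^ 3 * rootE4 ^ 18) = eulerProduct ^ 36 := by
  refine eq_of_mul_qDeriv_eq_mul (u := 2) (w := 3 * (qE2 - 1)) ?_ ?_ ?_ ?_ ?_
  · rw [qDeriv_mul, qDeriv_mul, qDeriv_pow_succ _ 17, qDeriv_pow_succ _ 2,
      qDeriv_one_sub_mirrorMap]
    push_cast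
    linear_combination
      (1 - 432 * mirrorMap) ^ 3 * rootE4 ^ 18 * qDeriv_flatRestriction_flatUnit_one
        + 3 * flatRestriction (flatUnit 1) * (1 - 432 * mirrorMap) ^ 3 * rootE4 ^ 17
          * qDeriv_rootE4
  · rw [qDeriv_pow_succ]
    push_cast
    linear_combination 3 * eulerProduct ^ 35 * qDeriv_eulerProduct
  · rw [map_ofNat]
    exact two_ne_zero
  · simp [constantCoeff_qE2]
  · simp [constantCoeff_flatRestriction, constantCoeff_flatUnit, constantCoeff_eulerProduct,
      constantCoeff_rootE4, constantCoeff_mirrorMap]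

end Periods

section LeadingCoefficient

lemma flatRestriction_flatCoord :
    (fun i => flatRestriction (flatCoord i)) = ![PowerSeries.X, 0] := by
  funext i
  rw [flatCoord_eq, map_mul, flatRestriction_apply (MvPowerSeries.X i), restrictBase_X]
  fin_cases i
  · exact (congrArg (· * _) compMirror_X).trans mirrorMap_mul_flatRestriction_flatUnit_zero
  · exact (congrArg (· * _) (map_zero compMirror)).trans (zero_mul _)

lemma flatRestriction_subst_flatCoord (F : Series) :
    flatRestriction (MvPowerSeries.subst flatCoord F) = restrictBase F := by
  have hsubst : MvPowerSeries.HasSubst fun i => restrictBase (flatCoord i) :=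
    MvPowerSeries.hasSubst_of_constantCoeff_zero fun i => by
      change PowerSeries.constantCoeff _ = 0
      rw [constantCoeff_restrictBase, flatCoord_eq, map_mul, MvPowerSeries.constantCoeff_X,
        zero_mul]
  have hrestrict : restrictBase (MvPowerSeries.subst flatCoord F)
      = MvPowerSeries.subst (fun i => restrictBase (flatCoord i)) F := by
    simp only [restrictBase_apply]
    rw [MvPowerSeries.subst_comp_subst_apply hasSubst_flatCoord hasSubst_restrictBase]
  have hcoord := flatRestriction_flatCoord
  simp only [flatRestriction_apply, compMirror_apply] at hcoord
  rw [flatRestriction_apply, compMirror_apply, hrestrict, PowerSeries.subst,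
    MvPowerSeries.subst_comp_subst_apply hsubst hasSubst_mirrorMap.const, restrictBase_apply,
    ← hcoord]
  rfl

lemma restrictBase_flatExpansion (G : Series) :
    restrictBase (flatExpansion G) = flatRestriction G := by
  rw [← flatRestriction_subst_flatCoord, subst_flatExpansion]

lemma flatExpansion_mul (G H : Series) :
    flatExpansion (G * H) = flatExpansion G * flatExpansion H := by
  refine (flatExpansion_unique ?_).symm
  rw [MvPowerSeries.subst_mul hasSubst_flatCoord, subst_flatExpansion, subst_flatExpansion]

lemma flatExpansion_flatCoord_pow (i : Fin 2) (n : ℕ) :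
    flatExpansion (flatCoord i ^ n) = MvPowerSeries.X i ^ n := by
  refine (flatExpansion_unique ?_).symm
  rw [MvPowerSeries.subst_pow hasSubst_flatCoord, MvPowerSeries.subst_X hasSubst_flatCoord]

lemma baseCoeff_flatCoord_pow_mul (n : ℕ) (H : Series) :
    baseCoeff (flatCoord 1 ^ n * H) n = flatRestriction H := by
  ext i
  rw [← restrictBase_flatExpansion, coeff_restrictBase, baseCoeff, PowerSeries.coeff_mk,
    flatExpansion_mul, flatExpansion_flatCoord_pow, MvPowerSeries.X_pow_eq,
    MvPowerSeries.coeff_monomial_mul]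
  simp

lemma flatRestriction_coe (P : Poly) : flatRestriction (P : Series)
    = MvPolynomial.aeval (![mirrorMap, 0] : Fin 2 → PowerSeries ℂ) P := by
  have halg : flatRestriction.comp (MvPolynomial.coeToMvPowerSeries.algHom ℂ)
      = MvPolynomial.aeval ![mirrorMap, 0] := by
    refine MvPolynomial.algHom_ext fun i => ?_
    rw [AlgHom.comp_apply, MvPolynomial.coeToMvPowerSeries.algHom_apply, MvPolynomial.aeval_X,
      Algebra.algebraMap_self, MvPowerSeries.map_id, RingHom.id_apply, MvPolynomial.coe_X,
      flatRestriction_apply, restrictBase_X]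
    fin_cases i
    · exact compMirror_X
    · exact map_zero compMirror
  have h := DFunLike.congr_fun halg P
  rwa [AlgHom.comp_apply, MvPolynomial.coeToMvPowerSeries.algHom_apply,
    Algebra.algebraMap_self, MvPowerSeries.map_id, RingHom.id_apply] at h

lemma flatRestriction_coe_aeval (p : Polynomial ℂ) :
    flatRestriction ((Polynomial.aeval (MvPolynomial.X 0 : Poly) p : Poly) : Series)
      = Polynomial.aeval mirrorMap p := by
  rw [flatRestriction_coe, ← Polynomial.aeval_algHom_apply, MvPolynomial.aeval_X]
  rfl

lemma flatRestriction_coe_disc :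
    flatRestriction ((disc1 * disc2 : Poly) : Series) = (1 - 432 * mirrorMap) ^ 3 := by
  rw [flatRestriction_coe, disc1, disc2]
  simp

lemma exists_X0_pow_mul_taylor_ambiguity (g n : ℕ) (p : Polynomial ℂ) : ∃ H : Series,
    X0 ^ (2 * g - 2) * taylor (ambiguity g n p) = flatCoord 1 ^ n * H ∧
      H * (flatUnit 1 ^ n * ((disc1 * disc2 : Poly) : Series) ^ (2 * g - 2))
        = X0 ^ (2 * g - 2)
          * ((Polynomial.aeval (MvPolynomial.X 0 : Poly) p : Poly) : Series) := by
  set d := 2 * g - 2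
  set D : Series := ((disc1 * disc2 : Poly) : Series) ^ d with hD
  set P : Series := ((Polynomial.aeval (MvPolynomial.X 0 : Poly) p : Poly) : Series)
  have hD0 : MvPowerSeries.constantCoeff D ≠ 0 := by
    rw [hD, map_pow, ← MvPowerSeries.coeff_zero_eq_constantCoeff_apply, MvPolynomial.coeff_coe,
      ← MvPolynomial.constantCoeff_eq]
    simp [disc1, disc2]
  have hDinv : D * D⁻¹ = 1 := MvPowerSeries.mul_inv_cancel _ hD0
  have hUinv : flatUnit 1 ^ n * (flatUnit 1)⁻¹ ^ n = 1 := by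
    rw [← mul_pow, MvPowerSeries.mul_inv_cancel _ (by simp [constantCoeff_flatUnit]), one_pow]
  refine ⟨(flatUnit 1)⁻¹ ^ n * (X0 ^ d * P * D⁻¹), ?_, ?_⟩
  · rw [taylor_ambiguity, MvPolynomial.coe_pow, ← hD, MvPolynomial.coe_mul, MvPolynomial.coe_pow,
      MvPolynomial.coe_X, flatCoord_eq, mul_pow]
    linear_combination -(MvPowerSeries.X 1 ^ n * X0 ^ d * P * D⁻¹) * hUinv
  · linear_combination X0 ^ d * P * (D * D⁻¹ * hUinv + hDinv)

lemma fibreCoeff_ambiguity (g n : ℕ) (p : Polynomial ℂ) :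
    fibreCoeff g (ambiguity g n p) n * (1 - 432 * mirrorMap) ^ (3 * (2 * g - 2))
      = rootE4 ^ (18 * n + (2 * g - 2))
        * (Polynomial.aeval mirrorMap p * (1 - 432 * mirrorMap) ^ (3 * n)) := by
  obtain ⟨H, hH, hHD⟩ := exists_X0_pow_mul_taylor_ambiguity g n p
  have hr := congrArg flatRestriction hHD
  simp only [map_mul, map_pow, flatRestriction_coe_disc, flatRestriction_coe_aeval,
    flatRestriction_X0] at hr
  rw [fibreCoeff, hH, baseCoeff_flatCoord_pow_mul, pow_mul eulerProduct,
    ← flatRestriction_flatUnit_one]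
  generalize 1 - 432 * mirrorMap = y at hr ⊢
  linear_combination (y ^ 3 * rootE4 ^ 18) ^ n * hr

end LeadingCoefficient

section ModularPolynomials

open Polynomial

variable {j k : ℕ} {P Q : ℂ[X]}

/-- The action on polynomials in `z₁` of the involution `z₁ ↦ 1/432 - z₁`. -/
def reflection : ℂ[X] →ₐ[ℂ] ℂ[X] := aeval (C (1 / 432) - X)

lemma mul_C_inv_432 : (432 * C (1 / 432) : ℂ[X]) = 1 := by
  rw [← map_ofNat C, ← C_mul]
  norm_num

lemma reflection_X : reflection X = C (1 / 432) - X := aeval_X _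

lemma reflection_mul_X : reflection (432 * X) = 1 - 432 * X := by
  rw [map_mul, map_ofNat, reflection_X]
  linear_combination mul_C_inv_432

lemma reflection_one_sub_mul_X : reflection (1 - 432 * X) = 432 * X := by
  rw [map_sub, map_one, reflection_mul_X]
  ring

lemma natDegree_one_sub_mul_X : (1 - 432 * X : ℂ[X]).natDegree = 1 := by
  rw [← map_ofNat C]
  compute_degree!

lemma one_sub_mul_X_ne_zero : (1 - 432 * X : ℂ[X]) ≠ 0 :=
  ne_zero_of_natDegree_gt (n := 0) (by rw [natDegree_one_sub_mul_X]; exact one_pos)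

lemma mul_X_ne_zero : (432 * X : ℂ[X]) ≠ 0 :=
  mul_ne_zero (OfNat.ofNat_ne_zero 432) X_ne_zero

lemma isCoprime_mul_X_one_sub_mul_X : IsCoprime (432 * X : ℂ[X]) (1 - 432 * X) :=
  ⟨1, 1, by ring⟩

/-- The polynomials in `z₁` that represent modular forms of weight `2k` after division by the
`2k`-th power of the holomorphic period. -/
structure IsModularPolynomial (k : ℕ) (Q : ℂ[X]) : Prop where
  natDegree_le : 3 * Q.natDegree ≤ k
  reflection_eq : reflection Q = (-1) ^ k * Q

namespace IsModularPolynomial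

lemma add (hP : IsModularPolynomial k P) (hQ : IsModularPolynomial k Q) :
    IsModularPolynomial k (P + Q) where
  natDegree_le := by
    have := natDegree_add_le P Q
    have := hP.natDegree_le
    have := hQ.natDegree_le
    lia
  reflection_eq := by rw [map_add, hP.reflection_eq, hQ.reflection_eq, mul_add]

lemma smul (c : ℂ) (hP : IsModularPolynomial k P) : IsModularPolynomial k (c • P) where
  natDegree_le := (Nat.mul_le_mul_left 3 (natDegree_smul_le c P)).trans hP.natDegree_le
  reflection_eq := by rw [map_smul, hP.reflection_eq, mul_smul_comm]

lemma mul (hP : IsModularPolynomial j P) (hQ : IsModularPolynomial k Q) :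
    IsModularPolynomial (j + k) (P * Q) where
  natDegree_le := by
    have := natDegree_mul_le (p := P) (q := Q)
    have := hP.natDegree_le
    have := hQ.natDegree_le
    lia
  reflection_eq := by
    rw [map_mul, hP.reflection_eq, hQ.reflection_eq, pow_add]
    ring

lemma zero (k : ℕ) : IsModularPolynomial k 0 := ⟨by simp, by simp⟩

lemma one (a : ℕ) : IsModularPolynomial (2 * a) 1 := ⟨by simp, by simp [pow_mul]⟩

lemma pow (hP : IsModularPolynomial k P) (n : ℕ) : IsModularPolynomial (n * k) (P ^ n) := by
  induction n with
  | zero => simpa using one 0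
  | succ n ih =>
    rw [pow_succ, Nat.succ_mul]
    exact ih.mul hP

lemma one_sub_864 : IsModularPolynomial 3 (1 - 864 * X) where
  natDegree_le := by
    have : (1 - 864 * X : ℂ[X]).natDegree ≤ 1 := by
      rw [← map_ofNat C]
      compute_degree
    lia
  reflection_eq := by
    rw [map_sub, map_one, map_mul, map_ofNat, reflection_X]
    linear_combination -2 * mul_C_inv_432

lemma X_mul_one_sub : IsModularPolynomial 6 (X * (1 - 432 * X)) where
  natDegree_le := by
    rw [natDegree_mul X_ne_zero one_sub_mul_X_ne_zero, natDegree_X, natDegree_one_sub_mul_X]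
  reflection_eq := by
    rw [map_mul, reflection_one_sub_mul_X, reflection_X]
    linear_combination X * mul_C_inv_432

lemma reflection_dvd (hQ : IsModularPolynomial k Q) (h : P ∣ Q) : reflection P ∣ Q := by
  have hdvd := map_dvd reflection h
  rwa [hQ.reflection_eq, (isUnit_neg_one.pow k).dvd_mul_left] at hdvd

lemma one_sub_dvd (hQ : IsModularPolynomial k Q) (h0 : Q.coeff 0 = 0) : 1 - 432 * X ∣ Q := by
  have hX : (432 * X : ℂ[X]) ∣ Q :=
    (IsUnit.of_mul_eq_one _ mul_C_inv_432).mul_left_dvd.mpr (X_dvd_iff.mpr h0)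
  exact reflection_mul_X ▸ hQ.reflection_dvd hX

lemma coeff_zero_eq_zero (hQ : IsModularPolynomial 1 Q) : Q.coeff 0 = 0 := by
  have hconst := eq_C_of_natDegree_eq_zero (p := Q) (by have := hQ.natDegree_le; lia)
  have hneg := hQ.reflection_eq
  rw [hconst, reflection, aeval_C, pow_one, neg_one_mul, ← C_neg] at hneg
  exact CharZero.eq_neg_self_iff.mp (C_injective hneg)

lemma exists_eq_pow_mul (hQ : IsModularPolynomial k Q) (hQ0 : Q ≠ 0) {K : ℕ}
    (h : (1 - 432 * X) ^ K ∣ Q) :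
    ∃ m R, k = 6 * K + m ∧ IsModularPolynomial m R ∧ Q = (X * (1 - 432 * X)) ^ K * R := by
  have hX : X ^ K ∣ Q := by
    have hdvd := hQ.reflection_dvd h
    rw [map_pow, reflection_one_sub_mul_X, mul_pow] at hdvd
    exact dvd_of_mul_left_dvd hdvd
  have hcoprime : IsCoprime (X : ℂ[X]) (1 - 432 * X) :=
    isCoprime_mul_X_one_sub_mul_X.of_mul_left_right
  obtain ⟨R, hR⟩ := hcoprime.pow.mul_dvd hX h
  rw [← mul_pow] at hR
  subst hR
  have hpow0 := left_ne_zero_of_mul hQ0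
  have hdeg := hQ.natDegree_le
  rw [natDegree_mul hpow0 (right_ne_zero_of_mul hQ0), natDegree_pow,
    natDegree_mul X_ne_zero one_sub_mul_X_ne_zero, natDegree_X, natDegree_one_sub_mul_X] at hdeg
  obtain ⟨m, rfl⟩ := Nat.exists_eq_add_of_le (show 6 * K ≤ k by lia)
  refine ⟨m, R, rfl, ⟨by lia, mul_left_cancel₀ hpow0 ?_⟩, rfl⟩
  have hrefl := hQ.reflection_eq
  rw [map_mul, (X_mul_one_sub.pow K).reflection_eq, pow_add, mul_comm K] at hrefl
  refine mul_left_cancel₀ (pow_ne_zero (6 * K) (neg_ne_zero.mpr one_ne_zero)) ?_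
  linear_combination hrefl

end IsModularPolynomial

/-- The power series in `q_E` represented in weight `2k` by a polynomial in `z₁`: the polynomial in
the inverse mirror map times the `2k`-th power of the holomorphic period. -/
def modularSeries (k : ℕ) : ℂ[X] →ₗ[ℂ] PowerSeries ℂ :=
  LinearMap.mulLeft ℂ (rootE4 ^ (2 * k)) ∘ₗ (aeval mirrorMap).toLinearMap

lemma modularSeries_apply (k : ℕ) (Q : ℂ[X]) :
    modularSeries k Q = rootE4 ^ (2 * k) * aeval mirrorMap Q := rfl

lemma modularSeries_injective (k : ℕ) : Function.Injective (modularSeries k) :=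
  (mul_right_injective₀ (pow_ne_zero _ rootE4_ne_zero)).comp
    (aeval_powerSeries_injective mirrorMap_ne_zero constantCoeff_mirrorMap)

lemma modularSeries_mul (j k : ℕ) (P Q : ℂ[X]) :
    modularSeries j P * modularSeries k Q = modularSeries (j + k) (P * Q) := by
  simp only [modularSeries_apply, map_mul]
  ring

lemma modularSeries_pow (n k : ℕ) (Q : ℂ[X]) :
    modularSeries k Q ^ n = modularSeries (n * k) (Q ^ n) := by
  simp only [modularSeries_apply, map_pow]
  ring

lemma qDelta_eq_modularSeries : qDelta = modularSeries 6 (X * (1 - 432 * X)) := by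
  simp only [qDelta_eq, modularSeries_apply, map_mul, map_sub, map_one, map_ofNat, aeval_X]

lemma qE4_pow_mul_qE6_pow (a b : ℕ) :
    qE4 ^ a * qE6 ^ b = modularSeries (2 * a + 3 * b) ((1 - 864 * X) ^ b) := by
  simp only [modularSeries_apply, map_pow, map_sub, map_one, map_mul, map_ofNat, aeval_X,
    ← rootE4_pow_four, qE6_eq, mul_pow]
  ring

lemma isLevelOneForm_qE4_pow_mul_qE6_pow (a b : ℕ) :
    IsLevelOneForm (2 * (2 * a + 3 * b : ℕ)) (qE4 ^ a * qE6 ^ b) := by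
  convert (isLevelOneForm_qE4.pow a).mul (isLevelOneForm_qE6.pow b) using 1
  push_cast
  ring

lemma isModularPolynomial_one_sub_864_pow (a b : ℕ) :
    IsModularPolynomial (2 * a + 3 * b) ((1 - 864 * X) ^ b) := by
  have := (IsModularPolynomial.one a).mul (IsModularPolynomial.one_sub_864.pow b)
  rwa [one_mul, mul_comm b] at this

lemma exists_eq_two_mul_add_three_mul (hk : k ≠ 1) : ∃ a b : ℕ, k = 2 * a + 3 * b := by
  rcases Nat.even_or_odd' k with ⟨a, rfl | rfl⟩
  · exact ⟨a, 0, by lia⟩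
  · exact ⟨a - 1, 1, by lia⟩

lemma IsLevelOneForm.constantCoeff_eq_zero_of_weight_two {F : PowerSeries ℂ}
    (hF : IsLevelOneForm 2 F) : PowerSeries.constantCoeff F = 0 := by
  obtain ⟨M, rfl⟩ := hF
  rw [rank_zero_iff_forall_zero.mp ModularForm.levelOne_weight_two_rank_zero M]
  exact congrArg PowerSeries.constantCoeff (UpperHalfPlane.qExpansion_zero 1)

lemma IsLevelOneForm.exists_eq_qDelta_mul {w : ℤ} {F : PowerSeries ℂ} (hF : IsLevelOneForm w F)
    (h0 : PowerSeries.constantCoeff F = 0) :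
    ∃ G, IsLevelOneForm (w - 12) G ∧ F = qDelta * G := by
  obtain ⟨M, rfl⟩ := hF
  have h := ModularForm.qExpansion_eq_qExpansion_discriminant_mul M
    (by rwa [PowerSeries.coeff_zero_eq_constantCoeff_apply])
  rw [qExpansion_discriminant] at h
  exact ⟨_, ⟨_, rfl⟩, h⟩

lemma IsLevelOneForm.exists_modularSeries {F : PowerSeries ℂ} (hF : IsLevelOneForm (2 * k) F) :
    ∃ Q, IsModularPolynomial k Q ∧ F = modularSeries k Q := by
  induction k using Nat.strong_induction_on generalizing F with
  | _ k ih =>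
  have hcusp {F : PowerSeries ℂ} (hF : IsLevelOneForm (2 * k) F)
      (h0 : PowerSeries.constantCoeff F = 0) :
      ∃ Q, IsModularPolynomial k Q ∧ F = modularSeries k Q := by
    obtain ⟨G, hG, rfl⟩ := hF.exists_eq_qDelta_mul h0
    rcases lt_or_ge k 6 with hk | hk
    · refine ⟨0, .zero k, ?_⟩
      rw [hG.eq_zero_of_neg (by lia), mul_zero, map_zero]
    · obtain ⟨m, rfl⟩ := Nat.exists_eq_add_of_le hk
      obtain ⟨R, hR, rfl⟩ := ih m (by lia) (F := G) (by convert hG using 1; push_cast; ring)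
      exact ⟨_, IsModularPolynomial.X_mul_one_sub.mul hR, by
        rw [qDelta_eq_modularSeries, modularSeries_mul]⟩
  rcases eq_or_ne k 1 with rfl | hk
  · exact hcusp hF (IsLevelOneForm.constantCoeff_eq_zero_of_weight_two (by simpa using hF))
  · obtain ⟨a, b, rfl⟩ := exists_eq_two_mul_add_three_mul hk
    set c := PowerSeries.constantCoeff F with hc
    obtain ⟨Q, hQ, h⟩ := hcusp
      (hF.add ((isLevelOneForm_qE4_pow_mul_qE6_pow a b).smul (-c)))
      (by simp [constantCoeff_qE4, constantCoeff_qE6, ← hc])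
    refine ⟨Q + c • (1 - 864 * X) ^ b,
      hQ.add ((isModularPolynomial_one_sub_864_pow a b).smul c), ?_⟩
    rw [map_add, map_smul, ← h, ← qE4_pow_mul_qE6_pow, neg_smul, neg_add_cancel_right]

lemma IsModularPolynomial.isLevelOneForm (hQ : IsModularPolynomial k Q) :
    IsLevelOneForm (2 * k) (modularSeries k Q) := by
  induction k using Nat.strong_induction_on generalizing Q with
  | _ k ih =>
  have hcusp {Q : ℂ[X]} (hQ : IsModularPolynomial k Q) (h0 : Q.coeff 0 = 0) :
      IsLevelOneForm (2 * k) (modularSeries k Q) := by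
    rcases eq_or_ne Q 0 with rfl | hQ0
    · rw [map_zero]
      exact IsLevelOneForm.zero _
    · obtain ⟨m, R, rfl, hR, rfl⟩ :=
        hQ.exists_eq_pow_mul hQ0 (K := 1) (by rw [pow_one]; exact hQ.one_sub_dvd h0)
      rw [pow_one, ← modularSeries_mul, ← qDelta_eq_modularSeries]
      convert isLevelOneForm_qDelta.mul (ih m (by lia) hR) using 1
      push_cast
      ring
  rcases eq_or_ne k 1 with rfl | hk
  · exact hcusp hQ hQ.coeff_zero_eq_zero
  · obtain ⟨a, b, rfl⟩ := exists_eq_two_mul_add_three_mul hk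
    set c := Q.coeff 0 with hc
    have hdiff := hcusp (hQ.add ((isModularPolynomial_one_sub_864_pow a b).smul (-c)))
      (by simp [coeff_zero_eq_eval_zero, hc])
    convert hdiff.add ((isLevelOneForm_qE4_pow_mul_qE6_pow a b).smul c) using 1
    rw [qE4_pow_mul_qE6_pow, map_add, map_smul, neg_smul, neg_add_cancel_right]

lemma isLevelOneForm_iff {F : PowerSeries ℂ} :
    IsLevelOneForm (2 * k) F ↔ ∃ Q, IsModularPolynomial k Q ∧ F = modularSeries k Q :=
  ⟨IsLevelOneForm.exists_modularSeries, fun ⟨_, hQ, hF⟩ => hF ▸ hQ.isLevelOneForm⟩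

end ModularPolynomials

section Involution

open Polynomial

variable {p Q : ℂ[X]} {a b : ℕ}

lemma reflection_mul_pow_eq (h : Q * (1 - 432 * X) ^ a = p * (1 - 432 * X) ^ b) :
    reflection Q * (432 * X) ^ a = reflection p * (432 * X) ^ b := by
  simpa only [map_mul reflection _ (_ ^ _), map_pow, reflection_one_sub_mul_X] using
    congrArg reflection h

lemma exists_mul_pow_eq_of_reflection {s : ℕ}
    (h : reflection p * (432 * X) ^ b * (1 - 432 * X) ^ a
      = (-1) ^ s * p * (432 * X) ^ a * (1 - 432 * X) ^ b) :
    ∃ Q, Q * (1 - 432 * X) ^ a = p * (1 - 432 * X) ^ b := by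
  rcases le_total a b with hab | hba
  · obtain ⟨m, rfl⟩ := Nat.exists_eq_add_of_le' hab
    exact ⟨p * (1 - 432 * X) ^ m, by ring⟩
  · obtain ⟨m, rfl⟩ := Nat.exists_eq_add_of_le' hba
    have hcancel : (1 - 432 * X) ^ m * reflection p = (-1) ^ s * (p * (432 * X) ^ m) := by
      refine mul_right_cancel₀ (mul_ne_zero (pow_ne_zero b mul_X_ne_zero)
        (pow_ne_zero b one_sub_mul_X_ne_zero)) ?_
      rw [pow_add, pow_add] at h
      linear_combination h
    have hdvd : (1 - 432 * X) ^ m ∣ p * (432 * X) ^ m :=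
      (isUnit_neg_one.pow s).dvd_mul_left.mp ⟨_, hcancel.symm⟩
    obtain ⟨Q, rfl⟩ := isCoprime_mul_X_one_sub_mul_X.symm.pow.dvd_of_dvd_mul_right hdvd
    exact ⟨Q, by ring⟩

lemma exists_reflection_eq_iff {s : ℕ} :
    (∃ Q, reflection Q = (-1) ^ s * Q ∧ Q * (1 - 432 * X) ^ a = p * (1 - 432 * X) ^ b)
      ↔ reflection p * (432 * X) ^ b * (1 - 432 * X) ^ a
        = (-1) ^ s * p * (432 * X) ^ a * (1 - 432 * X) ^ b := by
  constructor
  · rintro ⟨Q, hQ, hpQ⟩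
    rw [← reflection_mul_pow_eq hpQ, hQ]
    linear_combination (-1) ^ s * (432 * X) ^ a * hpQ
  · intro h
    obtain ⟨Q, hpQ⟩ := exists_mul_pow_eq_of_reflection h
    refine ⟨Q, ?_, hpQ⟩
    refine mul_right_cancel₀ (mul_ne_zero (pow_ne_zero a mul_X_ne_zero)
      (pow_ne_zero a one_sub_mul_X_ne_zero)) ?_
    rw [← mul_assoc, reflection_mul_pow_eq hpQ, h]
    linear_combination -(-1) ^ s * (432 * X) ^ a * hpQ

lemma natDegree_add_eq (hp : p ≠ 0) (h : Q * (1 - 432 * X) ^ a = p * (1 - 432 * X) ^ b) :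
    Q.natDegree + a = p.natDegree + b := by
  have hpow (c : ℕ) : (1 - 432 * X : ℂ[X]) ^ c ≠ 0 := pow_ne_zero c one_sub_mul_X_ne_zero
  have hQ : Q ≠ 0 := left_ne_zero_of_mul (h.trans_ne (mul_ne_zero hp (hpow b)))
  simpa only [natDegree_mul hQ (hpow a), natDegree_mul hp (hpow b), natDegree_pow,
    natDegree_one_sub_mul_X, mul_one] using congrArg natDegree h

lemma three_mul_natDegree_le_iff {h n : ℕ}
    (hpQ : Q * (1 - 432 * X) ^ (3 * (2 * h)) = p * (1 - 432 * X) ^ (3 * n)) :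
    3 * Q.natDegree ≤ 9 * n + h ↔ p.natDegree ≤ 19 * h / 3 := by
  rcases eq_or_ne p 0 with rfl | hp
  · rw [zero_mul] at hpQ
    simp [(mul_eq_zero.mp hpQ).resolve_right (pow_ne_zero _ one_sub_mul_X_ne_zero)]
  · have := natDegree_add_eq hp hpQ
    lia

lemma neg_one_pow_nine_mul_add {R : Type*} [Ring R] (n h : ℕ) :
    (-1 : R) ^ (9 * n + h) = (-1) ^ (n + h) := by
  rw [show 9 * n + h = 2 * (4 * n) + (n + h) by ring, pow_add, pow_mul, neg_one_sq, one_pow,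
    one_mul]

lemma exists_isModularPolynomial_iff {h n : ℕ} :
    (∃ Q, IsModularPolynomial (9 * n + h) Q
        ∧ Q * (1 - 432 * X) ^ (3 * (2 * h)) = p * (1 - 432 * X) ^ (3 * n))
      ↔ p.natDegree ≤ 19 * h / 3
        ∧ reflection p * (432 * X) ^ (3 * n) * (1 - 432 * X) ^ (3 * (2 * h))
          = (-1) ^ (n + h) * p * (432 * X) ^ (3 * (2 * h)) * (1 - 432 * X) ^ (3 * n) := by
  rw [← neg_one_pow_nine_mul_add, ← exists_reflection_eq_iff]
  constructor
  · rintro ⟨Q, hQ, hpQ⟩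
    exact ⟨(three_mul_natDegree_le_iff hpQ).mp hQ.natDegree_le, Q, hQ.reflection_eq, hpQ⟩
  · rintro ⟨hdeg, Q, hQ, hpQ⟩
    exact ⟨Q, ⟨(three_mul_natDegree_le_iff hpQ).mpr hdeg, hQ⟩, hpQ⟩

lemma aeval_z_injective : Function.Injective (aeval (z 0) : ℂ[X] →ₐ[ℂ] RatFun) := by
  have hz : (aeval (z 0) : ℂ[X] →ₐ[ℂ] RatFun)
      = (IsScalarTower.toAlgHom ℂ Poly RatFun).comp (aeval (MvPolynomial.X 0 : Poly)) := by
    ext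
    simp [z]
  rw [hz, AlgHom.coe_comp]
  exact (IsFractionRing.injective Poly RatFun).comp
    (transcendental_iff_injective.mp (MvPolynomial.transcendental_X ℂ 0))

lemma z_one_ne_zero : z 1 ≠ 0 :=
  (map_ne_zero_iff _ (IsFractionRing.injective Poly RatFun)).mpr (MvPolynomial.X_ne_zero _)

lemma algebraMap_disc_ne_zero : algebraMap Poly RatFun (disc1 * disc2) ≠ 0 := by
  refine (map_ne_zero_iff _ (IsFractionRing.injective Poly RatFun)).mpr fun h => ?_
  simpa [disc1, disc2] using congrArg MvPolynomial.constantCoeff h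

lemma aeval_z_mul_X : aeval (z 0) (432 * X : ℂ[X]) = 432 * z 0 := by
  rw [map_mul, map_ofNat, aeval_X]

lemma aeval_z_one_sub_mul_X : aeval (z 0) (1 - 432 * X : ℂ[X]) = 1 - 432 * z 0 := by
  rw [map_sub, map_one, aeval_z_mul_X]

lemma mul_z_ne_zero : 432 * z 0 ≠ 0 := by
  rw [← aeval_z_mul_X]
  exact (map_ne_zero_iff _ aeval_z_injective).mpr mul_X_ne_zero

lemma one_sub_mul_z_ne_zero : 1 - 432 * z 0 ≠ 0 := by
  rw [← aeval_z_one_sub_mul_X]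
  exact (map_ne_zero_iff _ aeval_z_injective).mpr one_sub_mul_X_ne_zero

lemma involution_aeval (p : ℂ[X]) :
    involution (aeval (z 0) p) = aeval (z 0) (reflection p) := by
  rw [← aeval_algHom_apply, involution_z0, reflection, ← aeval_algHom_apply, map_sub, aeval_X,
    aeval_C, map_div₀, map_one, map_ofNat]

lemma algebraMap_disc : algebraMap Poly RatFun (disc1 * disc2)
    = ((1 - 432 * z 0) ^ 3 - 27 * z 1 * (432 * z 0) ^ 3) * (1 + 27 * z 1) := by
  simp only [disc1, disc2, map_mul, map_sub, map_add, map_pow, map_one, map_ofNat]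
  rfl

/-- Up to the displayed cubes, the involution interchanges `Δ₁` and `Δ₂`. -/
lemma involution_disc : involution (algebraMap Poly RatFun (disc1 * disc2))
    = algebraMap Poly RatFun (disc1 * disc2) * (432 * z 0) ^ 3 / (1 - 432 * z 0) ^ 3 := by
  have hy := one_sub_mul_z_ne_zero
  have hreflect : 432 * (1 / 432 - z 0) = 1 - 432 * z 0 := by ring
  rw [algebraMap_disc]
  simp only [map_mul, map_sub, map_add, map_pow, map_one, map_ofNat, involution_z0, involution_z1,
    hreflect]
  field_simp
  ring

lemma aeval_z_mul_pow (r : ℂ[X]) (a b : ℕ) :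
    aeval (z 0) (r * (432 * X) ^ a * (1 - 432 * X) ^ b)
      = aeval (z 0) r * (432 * z 0) ^ a * (1 - 432 * z 0) ^ b := by
  rw [map_mul, map_mul, map_pow, map_pow, aeval_z_mul_X, aeval_z_one_sub_mul_X]

lemma involution_ambiguity (g n : ℕ) (p : ℂ[X]) : involution (ambiguity g n p)
    = (-1) ^ n * aeval (z 0)
        (reflection p * (432 * X) ^ (3 * n) * (1 - 432 * X) ^ (3 * (2 * g - 2)))
      * (z 1 ^ n / (algebraMap Poly RatFun (disc1 * disc2) ^ (2 * g - 2)
        * (432 * z 0) ^ (3 * (2 * g - 2)) * (1 - 432 * z 0) ^ (3 * n))) := by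
  have hy := one_sub_mul_z_ne_zero
  have hx := mul_z_ne_zero
  have hD := algebraMap_disc_ne_zero
  rw [ambiguity_apply, map_div₀, map_mul, map_pow, map_pow, involution_disc, involution_z1,
    involution_aeval, aeval_z_mul_pow]
  generalize algebraMap Poly RatFun (disc1 * disc2) = D at hD ⊢
  generalize 1 - 432 * z 0 = y at hy ⊢
  generalize 432 * z 0 = x at hx ⊢
  rw [neg_pow, div_pow, div_pow, mul_pow _ _ n, mul_pow _ _ (2 * g - 2)]
  simp only [← pow_mul]
  field_simp

lemma involution_ambiguity_iff (g n : ℕ) (p : ℂ[X]) :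
    involution (ambiguity g n p) = (-1) ^ (g - 1) * ambiguity g n p
      ↔ reflection p * (432 * X) ^ (3 * n) * (1 - 432 * X) ^ (3 * (2 * g - 2))
        = (-1) ^ (n + (g - 1)) * p * (432 * X) ^ (3 * (2 * g - 2))
          * (1 - 432 * X) ^ (3 * n) := by
  have hy := one_sub_mul_z_ne_zero
  have hx := mul_z_ne_zero
  have hD := algebraMap_disc_ne_zero
  rw [involution_ambiguity, ambiguity_apply, ← aeval_z_injective.eq_iff,
    aeval_z_mul_pow (_ * p)]
  generalize aeval (z 0) (reflection p * _ * _) = b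
  rw [map_mul (aeval (z 0)), map_pow, map_neg, map_one]
  generalize algebraMap Poly RatFun (disc1 * disc2) = D at hD ⊢
  generalize 1 - 432 * z 0 = y at hy ⊢
  generalize 432 * z 0 = x at hx ⊢
  set c := z 1 ^ n / (D ^ (2 * g - 2) * x ^ (3 * (2 * g - 2)) * y ^ (3 * n)) with hc
  have hc0 : (-1) ^ n * c ≠ 0 :=
    mul_ne_zero (pow_ne_zero _ (neg_ne_zero.mpr one_ne_zero)) (div_ne_zero
      (pow_ne_zero _ z_one_ne_zero) (mul_ne_zero (mul_ne_zero (pow_ne_zero _ hD)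
        (pow_ne_zero _ hx)) (pow_ne_zero _ hy)))
  have hsq : ((-1) ^ n * (-1) ^ n : RatFun) = 1 := by rw [← mul_pow, neg_one_mul, neg_neg, one_pow]
  have hclear : (-1) ^ (g - 1) * (aeval (z 0) p * z 1 ^ n / D ^ (2 * g - 2))
      = (-1) ^ (n + (g - 1)) * aeval (z 0) p * x ^ (3 * (2 * g - 2)) * y ^ (3 * n)
        * ((-1) ^ n * c) := by
    have hc' : aeval (z 0) p * z 1 ^ n / D ^ (2 * g - 2)
        = aeval (z 0) p * x ^ (3 * (2 * g - 2)) * y ^ (3 * n) * c := by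
      rw [hc]
      field_simp
    rw [hc', pow_add]
    linear_combination
      -(-1) ^ (g - 1) * aeval (z 0) p * x ^ (3 * (2 * g - 2)) * y ^ (3 * n) * c * hsq
  rw [hclear, mul_comm ((-1) ^ n) b, mul_assoc, mul_left_inj' hc0]

end Involution

section Isomorphism

open Polynomial

variable {h n k K : ℕ} {p Q : ℂ[X]} {w : ℤ} {F : PowerSeries ℂ}

lemma modularSeries_mul_one_sub_pow (k a : ℕ) (Q : ℂ[X]) :
    modularSeries k (Q * (1 - 432 * X) ^ a) = modularSeries k Q * (1 - 432 * mirrorMap) ^ a := by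
  simp only [modularSeries_apply, map_mul, map_pow, map_sub, map_one, map_ofNat, aeval_X, mul_assoc]

lemma one_sub_mirrorMap_ne_zero : 1 - 432 * mirrorMap ≠ 0 := fun h => by
  simpa [constantCoeff_mirrorMap] using congrArg PowerSeries.constantCoeff h

lemma fibreCoeff_eq_modularSeries_iff :
    fibreCoeff (h + 1) (ambiguity (h + 1) n p) n = modularSeries (9 * n + h) Q
      ↔ Q * (1 - 432 * X) ^ (3 * (2 * h)) = p * (1 - 432 * X) ^ (3 * n) := by
  have hamb : fibreCoeff (h + 1) (ambiguity (h + 1) n p) n * (1 - 432 * mirrorMap) ^ (3 * (2 * h))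
      = modularSeries (9 * n + h) (p * (1 - 432 * X) ^ (3 * n)) := by
    rw [modularSeries_mul_one_sub_pow, modularSeries_apply, mul_assoc,
      show 2 * (9 * n + h) = 18 * n + (2 * (h + 1) - 2) by lia]
    exact fibreCoeff_ambiguity (h + 1) n p
  rw [← (modularSeries_injective (9 * n + h)).eq_iff, ← hamb, modularSeries_mul_one_sub_pow,
    mul_left_inj' (pow_ne_zero _ one_sub_mirrorMap_ne_zero), eq_comm]

lemma mem_W0_iff {f : RatFun} : f ∈ W0 (h + 1) n
    ↔ f ∈ V0Top (h + 1) n ∧ IsLevelOneForm (2 * (9 * n + h : ℕ)) (fibreCoeff (h + 1) f n) := by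
  rw [show (2 * (9 * n + h : ℕ) : ℤ) = 18 * n + 2 * (h + 1 : ℕ) - 2 by push_cast; ring]
  exact Iff.rfl

lemma ambiguity_mem_W0_iff : ambiguity (h + 1) n p ∈ W0 (h + 1) n
    ↔ ∃ Q, IsModularPolynomial (9 * n + h) Q
      ∧ Q * (1 - 432 * X) ^ (3 * (2 * h)) = p * (1 - 432 * X) ^ (3 * n) := by
  rw [mem_W0_iff, and_iff_right ⟨p, rfl⟩, isLevelOneForm_iff]
  simp only [fibreCoeff_eq_modularSeries_iff]

lemma ambiguity_mem_V2_iff {m : ℕ} : ambiguity (h + 1) n p ∈ V2 (h + 1) m n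
    ↔ ambiguity (h + 1) n p ∈ V0 (h + 1) m n
      ∧ involution (ambiguity (h + 1) n p) = (-1) ^ h * ambiguity (h + 1) n p := by
  rw [mem_V2]
  refine and_congr_right fun hp => and_iff_right_of_imp fun hinv => ?_
  have hsmul : (-1) ^ h * ambiguity (h + 1) n p = (-1 : ℂ) ^ h • ambiguity (h + 1) n p := by
    rw [Algebra.smul_def, map_pow, map_neg, map_one]
  rw [hinv, Nat.add_sub_cancel, hsmul]
  exact Submodule.smul_mem _ _ hp

lemma ambiguity_injective (g n : ℕ) : Function.Injective (ambiguity g n) := by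
  intro p q hpq
  rwa [ambiguity_apply, ambiguity_apply,
    div_left_inj' (pow_ne_zero _ algebraMap_disc_ne_zero),
    mul_left_inj' (pow_ne_zero _ z_one_ne_zero), aeval_z_injective.eq_iff] at hpq

lemma ambiguity_mem_V0_iff {g m : ℕ} : ambiguity g n p ∈ V0 g m n ↔ p.natDegree ≤ m := by
  rw [V0, ← SetLike.mem_coe, Submodule.map_coe, (ambiguity_injective g n).mem_set_image,
    SetLike.mem_coe, mem_degreeLE, natDegree_le_iff_degree_le]

theorem W0_eq_V2 (h n : ℕ) : W0 (h + 1) n = V2 (h + 1) (19 * h / 3) n := by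
  have hamb (p : ℂ[X]) :
      ambiguity (h + 1) n p ∈ W0 (h + 1) n ↔ ambiguity (h + 1) n p ∈ V2 (h + 1) (19 * h / 3) n := by
    rw [ambiguity_mem_W0_iff, ambiguity_mem_V2_iff, ambiguity_mem_V0_iff,
      exists_isModularPolynomial_iff]
    exact and_congr_right fun _ => (involution_ambiguity_iff (h + 1) n p).symm
  ext f
  constructor
  · intro hf
    obtain ⟨p, rfl⟩ := hf.1
    exact (hamb p).mp hf
  · intro hf
    obtain ⟨p, -, rfl⟩ := (mem_V2.mp hf).1
    exact (hamb p).mpr hf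

lemma exists_mul_pow_eq_iff_pow_dvd {R : Type*} [CommRing R] [IsDomain R] {y Q : R} (hy : y ≠ 0)
    (a b : ℕ) : (∃ p, Q * y ^ a = p * y ^ b) ↔ y ^ (b - a) ∣ Q := by
  rw [← mul_dvd_mul_iff_right (pow_ne_zero a hy), ← pow_add]
  rcases le_total a b with hab | hba
  · rw [Nat.sub_add_cancel hab]
    exact exists_congr fun p => by rw [mul_comm p]
  · rw [Nat.sub_eq_zero_of_le hba, zero_add]
    exact iff_of_true ⟨Q * y ^ (a - b), by rw [mul_assoc, ← pow_add, Nat.sub_add_cancel hba]⟩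
      (dvd_mul_left _ _)

lemma exists_fibreCoeff_eq_iff : (∃ f ∈ W0 (h + 1) n, fibreCoeff (h + 1) f n = F)
    ↔ ∃ Q, IsModularPolynomial (9 * n + h) Q ∧ (1 - 432 * X) ^ (3 * (n - 2 * h)) ∣ Q
      ∧ F = modularSeries (9 * n + h) Q := by
  simp only [Nat.mul_sub, ← exists_mul_pow_eq_iff_pow_dvd one_sub_mul_X_ne_zero]
  constructor
  · rintro ⟨f, hf, rfl⟩
    obtain ⟨p, rfl⟩ := hf.1
    obtain ⟨Q, hQ, hpQ⟩ := ambiguity_mem_W0_iff.mp hf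
    exact ⟨Q, hQ, ⟨p, hpQ⟩, fibreCoeff_eq_modularSeries_iff.mpr hpQ⟩
  · rintro ⟨Q, hQ, ⟨p, hpQ⟩, rfl⟩
    exact ⟨_, ambiguity_mem_W0_iff.mpr ⟨Q, hQ, hpQ⟩, fibreCoeff_eq_modularSeries_iff.mpr hpQ⟩

lemma exists_pow_dvd_modularSeries_iff :
    (∃ Q, IsModularPolynomial k Q ∧ (1 - 432 * X) ^ K ∣ Q ∧ F = modularSeries k Q)
      ↔ ∃ G, IsLevelOneForm (2 * k - 12 * K) G ∧ qDelta ^ K * G = F := by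
  have hDelta (m : ℕ) (R : ℂ[X]) : qDelta ^ K * modularSeries m R
      = modularSeries (6 * K + m) ((X * (1 - 432 * X)) ^ K * R) := by
    rw [qDelta_eq_modularSeries, modularSeries_pow, modularSeries_mul, mul_comm K]
  constructor
  · rintro ⟨Q, hQ, hdvd, rfl⟩
    rcases eq_or_ne Q 0 with rfl | hQ0
    · exact ⟨0, .zero _, by rw [mul_zero, map_zero]⟩
    · obtain ⟨m, R, rfl, hR, rfl⟩ := hQ.exists_eq_pow_mul hQ0 hdvd
      refine ⟨modularSeries m R, ?_, hDelta m R⟩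
      convert hR.isLevelOneForm using 1
      push_cast
      ring
  · rintro ⟨G, hG, rfl⟩
    rcases lt_or_ge k (6 * K) with hk | hk
    · exact ⟨0, .zero k, dvd_zero _, by rw [hG.eq_zero_of_neg (by lia), mul_zero, map_zero]⟩
    · obtain ⟨m, rfl⟩ := Nat.exists_eq_add_of_le hk
      rw [show (2 * (6 * K + m : ℕ) - 12 * K : ℤ) = 2 * m by push_cast; ring] at hG
      obtain ⟨R, hR, rfl⟩ := hG.exists_modularSeries
      refine ⟨_, ?_, ?_, hDelta m R⟩
      · exact mul_comm K 6 ▸ (IsModularPolynomial.X_mul_one_sub.pow K).mul hR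
      · exact (pow_dvd_pow_of_dvd (dvd_mul_left _ _) K).mul_right R

/-- The map `f ↦ p_n` on `W₀`. -/
def leadingCoeff (g n : ℕ) : W0 g n →ₗ[ℂ] PowerSeries ℂ where
  toFun f := fibreCoeff g f n
  map_add' f h := fibreCoeff_add g n n f.2.1 h.2.1
  map_smul' c f := fibreCoeff_smul g n n c f.2.1

lemma leadingCoeff_injective (g n : ℕ) : Function.Injective (leadingCoeff g n) :=
  (injective_iff_map_eq_zero _).mpr fun f hf => by_contra fun hne =>
    fibreCoeff_ne_zero f.2.1 (fun h => hne (Subtype.ext h)) hf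

/-- The `q`-expansion of level one forms of a fixed weight as a linear map. -/
def qExpansionLinearMap (w : ℤ) : ModularForm 𝒮ℒ w →ₗ[ℂ] PowerSeries ℂ where
  toFun M := UpperHalfPlane.qExpansion 1 M
  map_add' M N := ModularForm.qExpansion_add one_pos one_mem_strictPeriods_SL M N
  map_smul' c M := ModularForm.qExpansion_smul one_pos one_mem_strictPeriods_SL c M

lemma qExpansionLinearMap_injective (w : ℤ) : Function.Injective (qExpansionLinearMap w) :=
  (injective_iff_map_eq_zero _).mpr fun M hM =>
    (ModularForm.qExpansion_eq_zero_iff one_pos one_mem_strictPeriods_SL M).mp hM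

lemma exists_linearEquiv_of_range_eq {R M N P : Type*} [Semiring R] [AddCommMonoid M]
    [AddCommMonoid N] [AddCommMonoid P] [Module R M] [Module R N] [Module R P] {f : M →ₗ[R] P}
    {g : N →ₗ[R] P} (hf : Function.Injective f) (hg : Function.Injective g)
    (hfg : LinearMap.range f = LinearMap.range g) : ∃ Φ : M ≃ₗ[R] N, ∀ x, g (Φ x) = f x :=
  ⟨.ofInjective f hf ≪≫ₗ .ofEq _ _ hfg ≪≫ₗ (LinearEquiv.ofInjective g hg).symm, fun _ =>
    congrArg Subtype.val ((LinearEquiv.ofInjective g hg).apply_symm_apply _)⟩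

theorem exists_linearEquiv_W0 (hw : w = 2 * (9 * n + h : ℕ) - 12 * (3 * (n - 2 * h) : ℕ)) :
    ∃ Φ : W0 (h + 1) n ≃ₗ[ℂ] ModularForm 𝒮ℒ w, ∀ f : W0 (h + 1) n,
      qDelta ^ (3 * (n - 2 * h)) * UpperHalfPlane.qExpansion 1 (Φ f)
        = fibreCoeff (h + 1) (f : RatFun) n := by
  subst hw
  refine exists_linearEquiv_of_range_eq (f := leadingCoeff (h + 1) n)
    (g := LinearMap.mulLeft ℂ (qDelta ^ (3 * (n - 2 * h))) ∘ₗ qExpansionLinearMap _)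
    (leadingCoeff_injective _ _)
    ((mul_right_injective₀ (pow_ne_zero _ qDelta_ne_zero)).comp
      (qExpansionLinearMap_injective _)) ?_
  ext F
  have hF : F ∈ LinearMap.range (leadingCoeff (h + 1) n)
      ↔ ∃ f ∈ W0 (h + 1) n, fibreCoeff (h + 1) f n = F := by
    simp [leadingCoeff]
  rw [hF, exists_fibreCoeff_eq_iff, exists_pow_dvd_modularSeries_iff]
  simp [IsLevelOneForm, qExpansionLinearMap]

end Isomorphism

end

end X18

theorem mainTheorem1 (g n : ℕ) (hg : 1 ≤ g) :
    X18.W0 g n = X18.V2 g (19 * (g - 1) / 3) n ∧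
    (n ≤ 2 * g - 2 →
      ∃ Φ : X18.W0 g n ≃ₗ[ℂ] ModularForm 𝒮ℒ (18 * (n : ℤ) + 2 * (g : ℤ) - 2),
        ∀ f : X18.W0 g n,
          UpperHalfPlane.qExpansion 1 (Φ f) = X18.fibreCoeff g (f : X18.RatFun) n) ∧
    (2 * g - 2 < n →
      ∃ Φ : X18.W0 g n ≃ₗ[ℂ] ModularForm 𝒮ℒ (74 * ((g : ℤ) - 1) - 18 * (n : ℤ)),
        ∀ f : X18.W0 g n,
          (PowerSeries.X * X18.eulerProduct ^ 24) ^ (3 * (n - (2 * g - 2)))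
            * UpperHalfPlane.qExpansion 1 (Φ f) = X18.fibreCoeff g (f : X18.RatFun) n) := by
  obtain ⟨h, rfl⟩ := Nat.exists_eq_add_of_le' hg
  refine ⟨X18.W0_eq_V2 h n, fun hn => ?_, fun hn => ?_⟩
  · obtain ⟨Φ, hΦ⟩ := X18.exists_linearEquiv_W0 (h := h) (n := n)
      (w := 18 * (n : ℤ) + 2 * ((h + 1 : ℕ) : ℤ) - 2) (by lia)
    exact ⟨Φ, fun f => by rw [← hΦ f, show 3 * (n - 2 * h) = 0 by lia, pow_zero, one_mul]⟩
  · exact X18.exists_linearEquiv_W0 (by lia)
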